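/- Let $k\ge 3$ and let $P_k=A_1A_2\cdots A_k$ be a convex $k$-gon in the plane (no three vertices collinear). For a permutation $\pi=\pi_1\pi_2\cdots\pi_{k-1}\in\mathbb S_{k-1}$ let $G_\pi$ be the graph on the vertex set $[k]=\{1,\dots,k\}$ in which $i<j$ are adjacent if and only if $\{\pi_a,\pi_{a+1},\dots,\pi_{a+j-i-1}\}=\{i,i+1,\dots,j-1\}$ for some $a$. Identify the vertex $i$ with $A_i$ and an edge $ij$ with the segment $A_iA_j$. Two distinct such segments cross if they have a common interior point. A dissection of $P_k$ is a set $D$ of pairwise non-crossing diagonals of $P_k$. Its regions are the smaller convex polygons into which $D$ cuts $P_k$, that is, the polygons with at least three vertices, all of them vertices of $P_k$, such that every side is a side of $P_k$ or a member of $D$ and no diagonal is a member of $D$. Theorem. (1) Let $\pi\in\mathbb S_{k-1}$, and let $D_\pi$ be the set of the diagonals of $P_k$ that are edges of $G_\pi$ and are not crossed by any edge of $G_\pi$. Then $D_\pi$ is a dissection of $P_k$. For every region of $D_\pi$, with $p$ vertices, say, the subgraph of $G_\pi$ induced on the vertices of the region is either the $p$-cycle formed by the sides of the region, with $p\neq 4$,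 or the complete graph on these vertices. Both ends of every edge of $G_\pi$ are vertices of a common region. (2) Conversely, let $D$ be any dissection of $P_k$, and let any set of its regions be chosen that contains all regions with exactly four vertices. Let $G$ be the graph on $[k]$ that is the union of the complete graphs on the vertex sets of the chosen regions and of the boundary cycles of the other regions. Then $G=G_\pi$ for some $\pi\in\mathbb S_{k-1}$. -/

import Mathlib

/-- The entries `π_{a+1}, …, π_{a+(j-i)}` of the word `π_1 π_2 … π_{k-1}` are, as a set, the
interval `{i, i+1, …, j-1}`, for some `a`. Entries and positions are counted from `0`. (If the
window of positions ran past the end of the word, its image would have fewer than `j - i`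
elements, so `a + (j - i) ≤ k - 1` holds automatically when `j ≤ k - 1`.) -/
def IsContiguous {k : ℕ} (π : Equiv.Perm (Fin (k - 1))) (i j : ℕ) : Prop :=
  ∃ a : ℕ, π '' {t | a ≤ t.val ∧ t.val < a + (j - i)} = {m | i ≤ m.val ∧ m.val < j}

/-- The graph `G_π`: vertices `i < j` are adjacent iff `{i, …, j-1}` is contiguous in `π`. -/
def permGraph {k : ℕ} (π : Equiv.Perm (Fin (k - 1))) : SimpleGraph (Fin k) where
  Adj i j := (i < j ∧ IsContiguous π i j) ∨ (j < i ∧ IsContiguous π j i)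
  symm := ⟨fun _ _ h => Or.symm h⟩
  loopless := ⟨fun i h => h.elim (fun h => lt_irrefl i h.1) (fun h => lt_irrefl i h.1)⟩

/-- Twice the signed area of the triangle `p q r`. -/
def signedArea (p q r : EuclideanSpace ℝ (Fin 2)) : ℝ :=
  (q 0 - p 0) * (r 1 - p 1) - (q 1 - p 1) * (r 0 - p 0)

/-- `A 0, A 1, …, A (k-1)` are the vertices, in this cyclic order (counterclockwise or clockwise),
of a (strictly) convex `k`-gon in the plane: all triples taken in the order of their indices turn
in the same direction. -/
def IsConvexPolygon {k : ℕ} (A : Fin k → EuclideanSpace ℝ (Fin 2)) : Prop :=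
  3 ≤ k ∧
    ((∀ i j l : Fin k, i < j → j < l → 0 < signedArea (A i) (A j) (A l)) ∨
      (∀ i j l : Fin k, i < j → j < l → signedArea (A i) (A j) (A l) < 0))

/-- The segments `A u A v` and `A x A y` are different and have a common interior point. -/
def Crosses {k : ℕ} (A : Fin k → EuclideanSpace ℝ (Fin 2)) (u v x y : Fin k) : Prop :=
  s(u, v) ≠ s(x, y) ∧ (openSegment ℝ (A u) (A v) ∩ openSegment ℝ (A x) (A y)).Nonempty

/-- The boundary of the polygon with vertex set `R`, its vertices being taken in the cyclic order
of `0, 1, …, k-1`: two distinct vertices in `R` are joined iff one of the two open arcs between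
them contains no vertex in `R`. For `#R ≥ 3` this is a cycle through all the vertices in `R`. -/
def boundary {k : ℕ} (R : Finset (Fin k)) : SimpleGraph (Fin k) where
  Adj u v := u ≠ v ∧ u ∈ R ∧ v ∈ R ∧
    ((∀ w ∈ R, ¬ (min u v < w ∧ w < max u v)) ∨ (∀ w ∈ R, min u v ≤ w ∧ w ≤ max u v))
  symm := ⟨fun u v h => ⟨h.1.symm, h.2.2.1, h.2.1, by
    rw [min_comm v u, max_comm v u]; exact h.2.2.2⟩⟩
  loopless := ⟨fun _ h => h.1 rfl⟩

/-- The complete graph on the vertices in `R`. -/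
def completeOn {k : ℕ} (R : Finset (Fin k)) : SimpleGraph (Fin k) where
  Adj u v := u ≠ v ∧ u ∈ R ∧ v ∈ R
  symm := ⟨fun _ _ h => ⟨h.1.symm, h.2.2, h.2.1⟩⟩
  loopless := ⟨fun _ h => h.1 rfl⟩

/-- A set `D` of segments between vertices (written as a graph) is a dissection of the convex
polygon `A` by non-crossing diagonals: its members are diagonals, that is, none of them is a side
of the polygon, and no two of them cross. -/
structure IsDissection {k : ℕ} (A : Fin k → EuclideanSpace ℝ (Fin 2))
    (D : SimpleGraph (Fin k)) : Prop where
  diagonal : ∀ u v, D.Adj u v → ¬ (boundary Finset.univ).Adj u v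
  noncrossing : ∀ u v x y, D.Adj u v → D.Adj x y → ¬ Crosses A u v x y

/-- `R` is the vertex set of one of the polygons into which the diagonals in `D` dissect the
`k`-gon: each side of the polygon on `R` is a side of the `k`-gon or a dissecting diagonal, and no
dissecting diagonal is a diagonal of the polygon on `R`. (As the members of `D` do not cross one
another, the last condition says that no dissecting diagonal passes through its interior.) -/
structure IsRegion {k : ℕ} (D : SimpleGraph (Fin k)) (R : Finset (Fin k)) : Prop where
  three_le_card : 3 ≤ R.card
  sides : ∀ u v, (boundary R).Adj u v → (boundary Finset.univ).Adj u v ∨ D.Adj u v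
  undivided : ∀ u ∈ R, ∀ v ∈ R, D.Adj u v → (boundary R).Adj u v

/-- The diagonals of the polygon `A` that are edges of `G` and are crossed by no edge of `G`. -/
def noncrossingDiagonals {k : ℕ} (A : Fin k → EuclideanSpace ℝ (Fin 2))
    (G : SimpleGraph (Fin k)) : SimpleGraph (Fin k) where
  Adj u v := G.Adj u v ∧ ¬ (boundary Finset.univ).Adj u v ∧
    ∀ x y, G.Adj x y → ¬ Crosses A u v x y
  symm := ⟨fun u v h => ⟨h.1.symm, fun h' => h.2.1 h'.symm, fun x y hxy hc =>
    h.2.2 x y hxy (by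
      unfold Crosses at hc ⊢
      rwa [Sym2.eq_swap, openSegment_symm])⟩⟩
  loopless := ⟨fun u h => G.irrefl h.1⟩

/-- The graph formed from the dissection `D` by turning each region in `K` into a complete graph
and leaving each other region as a cycle. -/
def dissectionGraph {k : ℕ} (D : SimpleGraph (Fin k)) (K : Set (Finset (Fin k))) :
    SimpleGraph (Fin k) where
  Adj u v := ∃ R, IsRegion D R ∧
    ((R ∈ K ∧ (completeOn R).Adj u v) ∨ (R ∉ K ∧ (boundary R).Adj u v))
  symm := ⟨fun _ _ ⟨R, hR, h⟩ =>
    ⟨R, hR, h.imp (fun h => ⟨h.1, h.2.symm⟩) (fun h => ⟨h.1, h.2.symm⟩)⟩⟩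
  loopless := ⟨fun _ ⟨_, _, h⟩ => h.elim (fun h => h.2.1 rfl) (fun h => h.2.1 rfl)⟩

/-!
Only the cyclic order of the vertices matters: two segments between vertices of a convex polygon
cross iff their ends interleave (`crosses_iff_interleaves`).

From a permutation to a dissection. If two contiguous intervals overlap, then their intersection,
differences and union are contiguous, so two crossing edges of `permGraph π` have pairwise adjacent
ends (`permGraph_isCrossClosed`). In a graph `G` with this property, an edge that crosses a side of
the polygon on a clique has an end adjacent to the whole clique. Hence no edge crosses a side of a
maximal clique with at least three vertices, and such a clique is a region of the dissection by the
uncrossed diagonals (`IsCrossClosed.exists_clique_region`). As an edge of `G` dividing a region is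
crossed and two regions share no diagonal, each region either has no edge as a diagonal or is
complete (`IsCrossClosed.adj_of_diagonal`). A bare 4-cycle is impossible: of three contiguous
intervals with a contiguous union, two consecutive ones are next to each other
(`IsBlock.union_of_three`). An edge of `G` is crossed by no dissecting diagonal, so a minimal
polygon cut out by the dissection and containing the edge is a region (`exists_region`).

From a dissection to a permutation. The entries of the permutation are the sides of the polygon
other than the one joining the last vertex to the first, and the same idea applies to every polygon
cut out by the dissection. A single region gets the increasing arrangement if it is complete, and a
simple permutation, which exists for every length from 4 on, if it is a cycle (`exists_simple`). Two
polygons with a common diagonal are glued by inflating an entry of the outer arrangement by the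
inner one or its reverse (`exists_block_inflation`). An interval overlapping the inflated entry
could be contiguous only if that entry were joined to its neighbours in the same sense, ascending or
descending, in which the inserted arrangement decomposes. It is not joined in both senses
(`Ascends.not_neg`), so one of the two orientations of the inserted arrangement avoids this.
-/

variable {k : ℕ}

/-! ### Interleaving pairs and crossing segments -/

/-- `x` lies strictly between `u` and `v` in the linear order of the indices, that is, on the open
arc from `u` to `v` that does not pass from `k - 1` to `0`. -/
def Between (u v x : Fin k) : Prop := (u < x ∧ x < v) ∨ (v < x ∧ x < u)

/-- `x` lies on the other open arc between `u` and `v`, the one that passes from `k - 1` to `0`. -/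
def Outside (u v x : Fin k) : Prop := (x < u ∧ x < v) ∨ (u < x ∧ v < x)

/-- The pair `x`, `y` separates the pair `u`, `v` on the circle: the combinatorial form of
`Crosses`. -/
def Interleaves (u v x y : Fin k) : Prop :=
  (Between u v x ∧ Outside u v y) ∨ (Between u v y ∧ Outside u v x)

theorem boundary_adj_iff {R : Finset (Fin k)} {u v : Fin k} :
    (boundary R).Adj u v ↔ u ≠ v ∧ u ∈ R ∧ v ∈ R ∧
      ((∀ w ∈ R, ¬ Between u v w) ∨ (∀ w ∈ R, ¬ Outside u v w)) := by
  have h1 : ∀ w, (min u v < w ∧ w < max u v) ↔ Between u v w := fun w => by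
    unfold Between; grind
  have h2 : ∀ w, (min u v ≤ w ∧ w ≤ max u v) ↔ ¬ Outside u v w := fun w => by
    unfold Outside; grind
  simp only [boundary, h1, h2]

theorem Interleaves.symm {u v x y : Fin k} (h : Interleaves u v x y) : Interleaves x y u v := by
  unfold Interleaves Between Outside at *; grind

theorem Interleaves.swap_left {u v x y : Fin k} (h : Interleaves u v x y) :
    Interleaves v u x y := by
  unfold Interleaves Between Outside at *; grind

theorem Interleaves.swap_right {u v x y : Fin k} (h : Interleaves u v x y) :
    Interleaves u v y x := h.symm.swap_left.symm

theorem signedArea_combo (p q x y : EuclideanSpace ℝ (Fin 2)) {a b : ℝ} (hab : a + b = 1) :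
    signedArea p q (a • x + b • y) = a * signedArea p q x + b * signedArea p q y := by
  obtain rfl : b = 1 - a := by linarith
  simp only [signedArea, PiLp.add_apply, PiLp.smul_apply, smul_eq_mul]
  ring

/-- Up to a global sign, which is the orientation of the polygon, all the triples in increasing
order have positive area. This lets both orientations be treated at once. -/
theorem IsConvexPolygon.exists_sign {A : Fin k → EuclideanSpace ℝ (Fin 2)}
    (hA : IsConvexPolygon A) : ∃ s : ℝ, ∀ i j l : Fin k, i < j → j < l →
      0 < s * signedArea (A i) (A j) (A l) := by
  rcases hA.2 with h | h
  · exact ⟨1, fun i j l hij hjl => by simpa using h i j l hij hjl⟩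
  · exact ⟨-1, fun i j l hij hjl => by simpa using h i j l hij hjl⟩

/-- The signed area with base `A u`, `A v` is an affine function vanishing on the line through these
two points. If the pairs do not interleave, it has a constant sign on the other open segment. -/
theorem openSegments_disjoint {A : Fin k → EuclideanSpace ℝ (Fin 2)} {s : ℝ}
    (hs : ∀ i j l : Fin k, i < j → j < l → 0 < s * signedArea (A i) (A j) (A l))
    {u v x y : Fin k} (huv : u < v) (hxy : x ≠ y) (hne : s(u, v) ≠ s(x, y))
    (h : ¬ Interleaves u v x y) :
    ¬ (openSegment ℝ (A u) (A v) ∩ openSegment ℝ (A x) (A y)).Nonempty := by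
  rintro ⟨P, ⟨a, b, ha, hb, hab, rfl⟩, ⟨c, d, hc, hd, hcd, hP⟩⟩
  have hin : ∀ w, u < w → w < v → s * signedArea (A u) (A v) (A w) < 0 := fun w h1 h2 => by
    have := hs u w v h1 h2
    have e : signedArea (A u) (A v) (A w) = - signedArea (A u) (A w) (A v) := by
      unfold signedArea; ring
    rw [e]; linarith
  have hout : ∀ w, w < u ∨ v < w → 0 < s * signedArea (A u) (A v) (A w) := by
    rintro w (h1 | h1)
    · have := hs w u v h1 huv
      have e : signedArea (A u) (A v) (A w) = signedArea (A w) (A u) (A v) := by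
        unfold signedArea; ring
      rwa [e]
    · exact hs u v w huv h1
  have hu : signedArea (A u) (A v) (A u) = 0 := by unfold signedArea; ring
  have hv : signedArea (A u) (A v) (A v) = 0 := by unfold signedArea; ring
  have key : c * (s * signedArea (A u) (A v) (A x)) +
      d * (s * signedArea (A u) (A v) (A y)) = 0 := by
    have h1 := signedArea_combo (A u) (A v) (A x) (A y) hcd
    rw [hP, signedArea_combo _ _ _ _ hab, hu, hv] at h1
    linear_combination -s * h1
  have pos : ∀ w, u < w ∧ w < v ∨ (w < u ∨ v < w) ∨ w = u ∨ w = v := fun w => by grind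
  have zero : ∀ w, w = u ∨ w = v → s * signedArea (A u) (A v) (A w) = 0 := by
    rintro w (rfl | rfl) <;> simp [hu, hv]
  rcases pos x with hx | hx | hx <;> rcases pos y with hy | hy | hy
  · nlinarith [hin x hx.1 hx.2, hin y hy.1 hy.2]
  · exact h (by unfold Interleaves Between Outside; grind)
  · nlinarith [hin x hx.1 hx.2, zero y hy]
  · exact h (by unfold Interleaves Between Outside; grind)
  · nlinarith [hout x hx, hout y hy]
  · nlinarith [hout x hx, zero y hy]
  · nlinarith [hin y hy.1 hy.2, zero x hx]
  · nlinarith [hout y hy, zero x hx]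
  · apply hne; rw [Sym2.eq_iff]; grind

/-- The weights of the common point are proportional to the areas of the four triangles formed by the
four vertices. -/
theorem openSegments_meet {A : Fin k → EuclideanSpace ℝ (Fin 2)} {s : ℝ}
    (hs : ∀ i j l : Fin k, i < j → j < l → 0 < s * signedArea (A i) (A j) (A l))
    {u v x y : Fin k} (h1 : u < x) (h2 : x < v) (h3 : v < y) :
    (openSegment ℝ (A u) (A v) ∩ openSegment ℝ (A x) (A y)).Nonempty := by
  set α := s * signedArea (A u) (A x) (A v) with hα
  set β := s * signedArea (A u) (A v) (A y) with hβ
  set γ := s * signedArea (A u) (A x) (A y) with hγ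
  set δ := s * signedArea (A x) (A v) (A y) with hδ
  have a0 : 0 < α := hs _ _ _ h1 h2
  have b0 : 0 < β := hs _ _ _ (h1.trans h2) h3
  have c0 : 0 < γ := hs _ _ _ h1 (h2.trans h3)
  have d0 : 0 < δ := hs _ _ _ h2 h3
  have e : α + β = γ + δ := by
    simp only [hα, hβ, hγ, hδ, signedArea]; ring
  have m0 : α + β ≠ 0 := by positivity
  have m1 : γ + δ ≠ 0 := by positivity
  refine ⟨(β / (α + β)) • A x + (α / (α + β)) • A y, ?_,
    ⟨β / (α + β), α / (α + β), by positivity, by positivity, by field_simp; ring, rfl⟩⟩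
  refine ⟨δ / (α + β), γ / (α + β), by positivity, by positivity, ?_, ?_⟩
  · field_simp; linarith
  · ext t
    simp only [PiLp.add_apply, PiLp.smul_apply, smul_eq_mul]
    field_simp
    simp only [hα, hβ, hγ, hδ, signedArea]
    fin_cases t <;> simp <;> ring

theorem crosses_iff_interleaves {A : Fin k → EuclideanSpace ℝ (Fin 2)} (hA : IsConvexPolygon A)
    {u v x y : Fin k} (huv : u ≠ v) (hxy : x ≠ y) :
    Crosses A u v x y ↔ Interleaves u v x y := by
  obtain ⟨s, hs⟩ := hA.exists_sign
  constructor
  · rintro ⟨hne, hn⟩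
    by_contra h
    rcases lt_or_gt_of_ne huv with h' | h'
    · exact openSegments_disjoint hs h' hxy hne h hn
    · rw [openSegment_symm] at hn
      rw [Sym2.eq_swap] at hne
      exact openSegments_disjoint hs h' hxy hne (fun h'' => h h''.swap_left) hn
  · intro h
    refine ⟨fun e => ?_, ?_⟩
    · rw [Sym2.eq_iff] at e
      unfold Interleaves Between Outside at h; grind
    · have : (∃ a b c d : Fin k, a < b ∧ b < c ∧ c < d ∧
          (s(u, v) = s(a, c) ∧ s(x, y) = s(b, d) ∨ s(u, v) = s(b, d) ∧ s(x, y) = s(a, c))) := by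
        simp only [Sym2.eq_iff]
        unfold Interleaves Between Outside at h
        rcases h with ⟨h | h, h' | h'⟩ | ⟨h | h, h' | h'⟩
        · exact ⟨y, u, x, v, by grind⟩
        · exact ⟨u, x, v, y, by grind⟩
        · exact ⟨y, v, x, u, by grind⟩
        · exact ⟨v, x, u, y, by grind⟩
        · exact ⟨x, u, y, v, by grind⟩
        · exact ⟨u, y, v, x, by grind⟩
        · exact ⟨x, v, y, u, by grind⟩
        · exact ⟨v, y, u, x, by grind⟩
      obtain ⟨a, b, c, d, h1, h2, h3, h4⟩ := this
      have hm := openSegments_meet hs h1 h2 h3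
      simp only [Sym2.eq_iff] at h4
      rcases h4 with ⟨⟨rfl, rfl⟩ | ⟨rfl, rfl⟩, ⟨rfl, rfl⟩ | ⟨rfl, rfl⟩⟩ |
        ⟨⟨rfl, rfl⟩ | ⟨rfl, rfl⟩, ⟨rfl, rfl⟩ | ⟨rfl, rfl⟩⟩
      · exact hm
      · rwa [openSegment_symm ℝ (A x)]
      · rwa [openSegment_symm ℝ (A u)]
      · rwa [openSegment_symm ℝ (A x), openSegment_symm ℝ (A u)]
      · rwa [Set.inter_comm]
      · rwa [Set.inter_comm, openSegment_symm ℝ (A x)]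
      · rwa [Set.inter_comm, openSegment_symm ℝ (A u)]
      · rwa [Set.inter_comm, openSegment_symm ℝ (A x), openSegment_symm ℝ (A u)]

/-! ### Boundaries, regions and dissections -/

theorem boundary_of_subset {R S : Finset (Fin k)} (hRS : R ⊆ S) {u v : Fin k} (hu : u ∈ R)
    (hv : v ∈ R) (h : (boundary S).Adj u v) : (boundary R).Adj u v := by
  rw [boundary_adj_iff] at *
  exact ⟨h.1, hu, hv, h.2.2.2.imp (fun h w hw => h w (hRS hw)) (fun h w hw => h w (hRS hw))⟩

theorem boundary_adj_of_card_le {R : Finset (Fin k)} (hR : R.card ≤ 3) {u v : Fin k} (huv : u ≠ v)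
    (hu : u ∈ R) (hv : v ∈ R) : (boundary R).Adj u v := by
  rw [boundary_adj_iff]
  refine ⟨huv, hu, hv, ?_⟩
  by_contra! h
  obtain ⟨⟨w, hw, hw'⟩, ⟨x, hx, hx'⟩⟩ := h
  have hsub : ({u, v, w, x} : Finset (Fin k)) ⊆ R := by
    intro t; simp only [Finset.mem_insert, Finset.mem_singleton]; grind
  have hc : ({u, v, w, x} : Finset (Fin k)).card = 4 := by
    unfold Between Outside at *
    rw [Finset.card_insert_of_notMem, Finset.card_insert_of_notMem, Finset.card_insert_of_notMem,
      Finset.card_singleton] <;> simp only [Finset.mem_insert, Finset.mem_singleton] <;> grind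
  have := Finset.card_le_card hsub
  omega

/-- A vertex `p` outside the polygon on `R` is cut off from that polygon by one of its sides `r s`,
and this side is not a side of the whole polygon. -/
theorem exists_gap {R : Finset (Fin k)} (hR : 3 ≤ R.card) {p : Fin k} (hp : p ∉ R) :
    ∃ r ∈ R, ∃ s ∈ R, (boundary R).Adj r s ∧ ¬ (boundary Finset.univ).Adj r s ∧
      ∀ t ∈ R, t ≠ r → t ≠ s → Interleaves r s p t := by
  have third : ∀ r s, ∃ t ∈ R, t ≠ r ∧ t ≠ s := by
    intro r s
    by_contra! h
    have hsub : R ⊆ {r, s} := by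
      intro t ht; simp only [Finset.mem_insert, Finset.mem_singleton]; grind
    have := (Finset.card_le_card hsub).trans Finset.card_le_two
    omega
  suffices h : ∃ r ∈ R, ∃ s ∈ R, r < s ∧
      ((r < p ∧ p < s ∧ ∀ w ∈ R, w ≤ r ∨ s ≤ w) ∨
        ((p < r ∨ s < p) ∧ ∀ w ∈ R, r ≤ w ∧ w ≤ s)) by
    obtain ⟨r, hr, s, hs, hrs, h⟩ := h
    obtain ⟨t, ht, htr, hts⟩ := third r s
    have hint : ∀ t ∈ R, t ≠ r → t ≠ s → Interleaves r s p t := by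
      intro t ht htr hts
      unfold Interleaves Between Outside; grind
    refine ⟨r, hr, s, hs, ?_, ?_, hint⟩
    · rw [boundary_adj_iff]
      refine ⟨hrs.ne, hr, hs, ?_⟩
      unfold Between Outside; grind
    · rw [boundary_adj_iff]
      rintro ⟨-, -, -, h'⟩
      have := hint t ht htr hts
      rcases h' with h' | h'
      · have h1 := h' p (Finset.mem_univ _)
        have h2 := h' t (Finset.mem_univ _)
        unfold Interleaves at this; tauto
      · have h1 := h' p (Finset.mem_univ _)
        have h2 := h' t (Finset.mem_univ _)
        unfold Interleaves at this; tauto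
  by_cases h1 : ∃ r ∈ R, r < p
  · by_cases h2 : ∃ s ∈ R, p < s
    · have n1 : (R.filter (· < p)).Nonempty := by
        obtain ⟨r, hr⟩ := h1; exact ⟨r, by simpa using hr⟩
      have n2 : (R.filter (p < ·)).Nonempty := by
        obtain ⟨r, hr⟩ := h2; exact ⟨r, by simpa using hr⟩
      have m1 := Finset.max'_mem _ n1
      have m2 := Finset.min'_mem _ n2
      have l1 := Finset.le_max' (R.filter (· < p))
      have l2 := Finset.min'_le (R.filter (p < ·))
      simp only [Finset.mem_filter] at m1 m2 l1 l2
      refine ⟨_, m1.1, _, m2.1, m1.2.trans m2.2, Or.inl ⟨m1.2, m2.2, fun w hw => ?_⟩⟩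
      rcases lt_trichotomy w p with h | h | h
      · exact Or.inl (l1 w ⟨hw, h⟩)
      · exact absurd (h ▸ hw) hp
      · exact Or.inr (l2 w ⟨hw, h⟩)
    · have n : R.Nonempty := by obtain ⟨r, hr⟩ := h1; exact ⟨r, hr.1⟩
      refine ⟨_, R.min'_mem n, _, R.max'_mem n, R.min'_lt_max'_of_card (by omega), Or.inr
        ⟨Or.inr ?_, fun w hw => ⟨R.min'_le w hw, R.le_max' w hw⟩⟩⟩
      have := R.max'_mem n
      push Not at h2
      exact lt_of_le_of_ne (h2 _ this) (fun e => hp (e ▸ this))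
  · have n : R.Nonempty := Finset.card_pos.mp (by omega)
    refine ⟨_, R.min'_mem n, _, R.max'_mem n, R.min'_lt_max'_of_card (by omega), Or.inr
      ⟨Or.inl ?_, fun w hw => ⟨R.min'_le w hw, R.le_max' w hw⟩⟩⟩
    have := R.min'_mem n
    push Not at h1
    exact lt_of_le_of_ne (h1 _ this) (fun e => hp (e ▸ this))

/-- The combinatorial form of the condition that no two members of `D` cross. -/
def IsNoncrossing (D : SimpleGraph (Fin k)) : Prop :=
  ∀ u v x y, D.Adj u v → D.Adj x y → ¬ Interleaves u v x y

/-- A member of `D` does not cross any segment between two vertices of a region. If it has an end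
outside the region, it is cut off together with this end by a side of the region in `D`. -/
theorem IsRegion.not_interleaves {D : SimpleGraph (Fin k)} (hD : IsNoncrossing D)
    {R : Finset (Fin k)} (hR : IsRegion D R) {u v p q : Fin k} (hu : u ∈ R) (hv : v ∈ R)
    (hpq : D.Adj p q) : ¬ Interleaves u v p q := by
  have key : ∀ {p q : Fin k}, D.Adj p q → p ∉ R → ¬ Interleaves u v p q := by
    intro p q hpq hp h
    obtain ⟨r, hr, s, hs, hrs, hns, ht⟩ := exists_gap hR.three_le_card hp
    have hrs' := (hR.sides r s hrs).resolve_left hns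
    have h0 := hD r s p q hrs' hpq
    have h1 := ht u hu
    have h2 := ht v hv
    unfold Interleaves Between Outside at *
    grind
  intro h
  by_cases hp : p ∈ R
  · by_cases hq : q ∈ R
    · obtain ⟨-, -, -, hb⟩ := boundary_adj_iff.1 (hR.undivided p hp q hq hpq)
      have h' := h.symm
      unfold Interleaves at h'
      grind
    · exact key hpq.symm hq h.swap_right
  · exact key hpq hp h

/-- A vertex of `R` missing from `S` would be cut off from `S` by a side of `S` in `D`; this side
would cross a segment from that vertex to `u` or to `v`, or else be `u v` and divide `R`. -/
theorem IsRegion.subset {D : SimpleGraph (Fin k)} (hD : IsNoncrossing D)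
    {R S : Finset (Fin k)} (hR : IsRegion D R) (hS : IsRegion D S) {u v : Fin k} (huv : u ≠ v)
    (huR : u ∈ R) (hvR : v ∈ R) (huS : u ∈ S) (hvS : v ∈ S) (hb : ¬ (boundary R).Adj u v) :
    R ⊆ S := by
  intro x hx
  by_contra hxS
  obtain ⟨r, hr, s, hs, hrs, hns, ht⟩ := exists_gap hS.three_le_card hxS
  have hrs' := (hS.sides r s hrs).resolve_left hns
  have key : ∀ t ∈ R, t ∈ S → t = r ∨ t = s := by
    intro t htR htS
    by_contra! h
    exact hR.not_interleaves hD hx htR hrs' (ht t htS h.1 h.2).symm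
  have : D.Adj u v := by
    rcases key u huR huS with rfl | rfl <;> rcases key v hvR hvS with rfl | rfl
    · exact absurd rfl huv
    · exact hrs'
    · exact hrs'.symm
    · exact absurd rfl huv
  exact hb (hR.undivided u huR v hvR this)

/-- Two regions that share a diagonal of one of them coincide. -/
theorem IsRegion.eq_of_not_boundary {D : SimpleGraph (Fin k)} (hD : IsNoncrossing D)
    {R S : Finset (Fin k)} (hR : IsRegion D R) (hS : IsRegion D S) {u v : Fin k} (huv : u ≠ v)
    (huR : u ∈ R) (hvR : v ∈ R) (huS : u ∈ S) (hvS : v ∈ S) (hb : ¬ (boundary R).Adj u v) :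
    R = S := by
  refine (hR.subset hD hS huv huR hvR huS hvS hb).antisymm
    (hS.subset hD hR huv huS hvS huR hvR fun h => hb ?_)
  rcases hS.sides u v h with h | h
  · exact boundary_of_subset (Finset.subset_univ _) huR hvR h
  · exact hR.undivided u huR v hvR h

/-! ### Splitting polygons along diagonals -/

/-- The polygon on `V` is a union of regions of `D`: all its sides are sides of the whole polygon or
members of `D`. A two-element `V` is allowed and stands for a single such segment. -/
def IsCutOut (D : SimpleGraph (Fin k)) (V : Finset (Fin k)) : Prop :=
  ∀ u v, (boundary V).Adj u v → (boundary Finset.univ).Adj u v ∨ D.Adj u v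

theorem IsCutOut.inner {D : SimpleGraph (Fin k)} {V : Finset (Fin k)} (hV : IsCutOut D V)
    {i j : Fin k} (hi : i ∈ V) (hj : j ∈ V) (hij : i < j) (hD : D.Adj i j) :
    IsCutOut D (V.filter fun x => i ≤ x ∧ x ≤ j) := by
  intro u v h
  by_cases he : (u = i ∧ v = j) ∨ (u = j ∧ v = i)
  · rcases he with ⟨rfl, rfl⟩ | ⟨rfl, rfl⟩
    · exact Or.inr hD
    · exact Or.inr hD.symm
  · apply hV
    rw [boundary_adj_iff] at *
    simp only [Finset.mem_filter] at h
    refine ⟨h.1, h.2.1.1, h.2.2.1.1, Or.inl ?_⟩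
    obtain ⟨h0, h1, h2, h3 | h3⟩ := h
    · unfold Between at *; grind
    · have := h3 i ⟨hi, le_rfl, hij.le⟩
      have := h3 j ⟨hj, hij.le, le_rfl⟩
      unfold Between Outside at *; grind

theorem IsCutOut.outer {D : SimpleGraph (Fin k)} {V : Finset (Fin k)} (hV : IsCutOut D V)
    {i j : Fin k} (hi : i ∈ V) (hj : j ∈ V) (hij : i < j) (hD : D.Adj i j) :
    IsCutOut D (V.filter fun x => ¬ (i < x ∧ x < j)) := by
  intro u v h
  by_cases he : (u = i ∧ v = j) ∨ (u = j ∧ v = i)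
  · rcases he with ⟨rfl, rfl⟩ | ⟨rfl, rfl⟩
    · exact Or.inr hD
    · exact Or.inr hD.symm
  · apply hV
    rw [boundary_adj_iff] at *
    simp only [Finset.mem_filter] at h
    obtain ⟨h0, h1, h2, h3 | h3⟩ := h
    · refine ⟨h0, h1.1, h2.1, Or.inl ?_⟩
      have := h3 i ⟨hi, by simp⟩
      have := h3 j ⟨hj, by simp⟩
      unfold Between at *; grind
    · refine ⟨h0, h1.1, h2.1, Or.inr ?_⟩
      have := h3 i ⟨hi, by simp⟩
      have := h3 j ⟨hj, by simp⟩
      unfold Outside at *; grind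

theorem exists_cut {D : SimpleGraph (Fin k)} {V : Finset (Fin k)} (hV : IsCutOut D V)
    (hc : 3 ≤ V.card) (hR : ¬ IsRegion D V) :
    ∃ i ∈ V, ∃ j ∈ V, i < j ∧ D.Adj i j ∧ (∃ w ∈ V, i < w ∧ w < j) ∧
      (∃ w ∈ V, w < i ∨ j < w) := by
  have : ∃ i ∈ V, ∃ j ∈ V, D.Adj i j ∧ ¬ (boundary V).Adj i j := by
    by_contra! h
    exact hR ⟨hc, hV, h⟩
  obtain ⟨i, hi, j, hj, hij, hb⟩ := this
  wlog hlt : i < j generalizing i j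
  · exact this j hj i hi hij.symm (fun h => hb h.symm)
      (lt_of_le_of_ne (not_lt.1 hlt) hij.ne.symm)
  refine ⟨i, hi, j, hj, hlt, hij, ?_, ?_⟩
  · by_contra! h
    exact hb (boundary_adj_iff.2 ⟨hij.ne, hi, hj, Or.inl (by unfold Between; grind)⟩)
  · by_contra! h
    exact hb (boundary_adj_iff.2 ⟨hij.ne, hi, hj, Or.inr (by unfold Outside; grind)⟩)

/-- The region is a minimal cut-out polygon containing both vertices: any dissecting diagonal would
split it into two smaller ones, one of which still contains `u` and `v`. -/
theorem exists_region {D : SimpleGraph (Fin k)} (hk : 3 ≤ k) {u v : Fin k}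
    (h : ∀ p q, D.Adj p q → ¬ Interleaves u v p q) :
    ∃ R, IsRegion D R ∧ u ∈ R ∧ v ∈ R := by
  suffices H : ∀ n, ∀ V : Finset (Fin k), V.card = n → 3 ≤ V.card → IsCutOut D V → u ∈ V → v ∈ V →
      ∃ R, IsRegion D R ∧ u ∈ R ∧ v ∈ R from
    H _ Finset.univ rfl (by simpa using hk) (fun _ _ h => Or.inl h) (Finset.mem_univ _)
      (Finset.mem_univ _)
  intro n
  induction n using Nat.strong_induction_on with
  | _ n ih =>
    rintro V rfl hc hV hu hv
    by_cases hR : IsRegion D V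
    · exact ⟨V, hR, hu, hv⟩
    obtain ⟨i, hi, j, hj, hij, hD, ⟨w, hw, hw'⟩, ⟨x, hx, hx'⟩⟩ := exists_cut hV hc hR
    have hu' := h i j hD
    by_cases hin : (i ≤ u ∧ u ≤ j) ∧ (i ≤ v ∧ v ≤ j)
    · refine ih _ (Finset.card_lt_card ?_) _ rfl ?_ (hV.inner hi hj hij hD) ?_ ?_
      · exact Finset.filter_ssubset.2 ⟨x, hx, by grind⟩
      · exact Finset.two_lt_card.2 ⟨i, by simp [hi, hij.le], w, by simp [hw, hw'.1.le, hw'.2.le],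
          j, by simp [hj, hij.le], by grind⟩
      · simp [hu, hin]
      · simp [hv, hin]
    · refine ih _ (Finset.card_lt_card ?_) _ rfl ?_ (hV.outer hi hj hij hD) ?_ ?_
      · exact Finset.filter_ssubset.2 ⟨w, hw, by grind⟩
      · exact Finset.two_lt_card.2 ⟨i, by simp [hi], x, by simp [hx]; grind,
          j, by simp [hj], by grind⟩
      · simp only [Finset.mem_filter]
        unfold Interleaves Between Outside at hu'; grind
      · simp only [Finset.mem_filter]
        unfold Interleaves Between Outside at hu'; grind

/-! ### Graphs closed under crossing -/

/-- Whenever two edges of `G` cross, their four ends are pairwise adjacent. It suffices to ask for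
one of the four remaining edges, since the ends of each edge may be interchanged. -/
def IsCrossClosed (G : SimpleGraph (Fin k)) : Prop :=
  ∀ u v x y, G.Adj u v → G.Adj x y → Interleaves u v x y → G.Adj u x

/-- If an edge of `G` crosses a side of the polygon on a clique, the end of that edge beyond the
side is adjacent to every vertex of the clique. -/
theorem IsCrossClosed.adj_all {G : SimpleGraph (Fin k)} (hG : IsCrossClosed G)
    {C : Finset (Fin k)} (hC : ∀ a ∈ C, ∀ b ∈ C, a ≠ b → G.Adj a b) {r s x y : Fin k}
    (hrs : (boundary C).Adj r s) (hxy : G.Adj x y) (h : Interleaves r s x y) :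
    ∃ z, z ∉ C ∧ ∀ c ∈ C, G.Adj c z := by
  obtain ⟨hne, hr, hs, hb⟩ := boundary_adj_iff.1 hrs
  -- Let `x` be the end beyond the side `r s`, that is, on the arc without vertices of the clique.
  wlog hx : ∀ c ∈ C, c ≠ r → c ≠ s → Interleaves r s x c generalizing x y with hw
  · refine hw hxy.symm h.swap_right fun c hc hcr hcs => ?_
    by_contra hy
    apply hx
    intro c' hc' hcr' hcs'
    have := hb.imp (fun h => And.intro (h c hc) (h c' hc')) (fun h => And.intro (h c hc) (h c' hc'))
    clear hx hC hb hw
    unfold Interleaves Between Outside at *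
    grind
  refine ⟨x, fun hxC => ?_, fun c hc => ?_⟩
  · have := hx x hxC
    unfold Interleaves Between Outside at *
    grind
  · have hrs' := hC r hr s hs hne
    by_cases hcr : c = r
    · subst hcr; exact hG _ _ _ _ hrs' hxy h
    by_cases hcs : c = s
    · subst hcs; exact hG _ _ _ _ hrs'.symm hxy h.swap_left
    by_cases hcy : c = y
    · subst hcy; exact hxy.symm
    have h1 := hx c hc hcr hcs
    -- The edge `x y` separates `c` from one of `r` and `s`.
    have : Interleaves c r x y ∨ Interleaves c s x y := by
      unfold Interleaves Between Outside at *
      grind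
    rcases this with h2 | h2
    · exact hG _ _ _ _ (hC c hc r hr hcr) hxy h2
    · exact hG _ _ _ _ (hC c hc s hs hcs) hxy h2

/-- A maximal clique of `G` with at least three vertices is a region of the dissection by the
uncrossed diagonals, because no edge of `G` crosses one of its sides. -/
theorem IsCrossClosed.exists_clique_region {G D : SimpleGraph (Fin k)} (hG : IsCrossClosed G)
    (hD : ∀ u v, D.Adj u v ↔ G.Adj u v ∧ ¬ (boundary Finset.univ).Adj u v ∧
      ∀ x y, G.Adj x y → ¬ Interleaves u v x y) {S : Finset (Fin k)} (hS : 3 ≤ S.card)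
    (hclique : ∀ a ∈ S, ∀ b ∈ S, a ≠ b → G.Adj a b) :
    ∃ C, S ⊆ C ∧ IsRegion D C ∧ ∀ a ∈ C, ∀ b ∈ C, a ≠ b → G.Adj a b := by
  obtain ⟨C, hSC, hmax⟩ := Finite.exists_le_maximal
    (p := fun C : Finset (Fin k) => ∀ a ∈ C, ∀ b ∈ C, a ≠ b → G.Adj a b) hclique
  have hC := hmax.prop
  refine ⟨C, hSC, ⟨hS.trans (Finset.card_le_card hSC), fun u v huv => ?_, fun u hu v hv huv => ?_⟩,
    hC⟩
  · by_contra! h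
    obtain ⟨hne, hu, hv, -⟩ := boundary_adj_iff.1 huv
    have : ∃ x y, G.Adj x y ∧ Interleaves u v x y := by
      by_contra! h'
      exact h.2 ((hD u v).2 ⟨hC u hu v hv hne, h.1, h'⟩)
    obtain ⟨x, y, hxy, hi⟩ := this
    obtain ⟨z, hz, hz'⟩ := hG.adj_all hC huv hxy hi
    have hcl : ∀ a ∈ insert z C, ∀ b ∈ insert z C, a ≠ b → G.Adj a b := by
      intro a ha b hb hab
      rw [Finset.mem_insert] at ha hb
      rcases ha with rfl | ha <;> rcases hb with rfl | hb
      · exact absurd rfl hab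
      · exact (hz' b hb).symm
      · exact hz' a ha
      · exact hC a ha b hb hab
    exact hz (hmax.le_of_ge hcl (Finset.subset_insert z C) (Finset.mem_insert_self z C))
  · by_contra hb
    have hne := huv.ne
    rw [boundary_adj_iff] at hb
    have : ∃ w ∈ C, ∃ x ∈ C, Between u v w ∧ Outside u v x := by grind
    obtain ⟨w, hw, x, hx, h1, h2⟩ := this
    refine ((hD u v).1 huv).2.2 w x (hC w hw x hx ?_) (Or.inl ⟨h1, h2⟩)
    unfold Between Outside at *; grind

/-! ### Blocks of an arrangement -/

/-- An arrangement of the letters of `V` in a row is encoded by a position function `pos`. The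
letters are the vertices in `V` other than the largest one, `M`; the letter `x` stands for the step
from `x` to the next vertex in `V`. The set of the letters from `a` (inclusive) to `b` (exclusive)
is a block if no other letter is placed between two of its members. For `V = univ` this is
contiguity in the permutation. -/
def IsBlock (V : Finset (Fin k)) (M : Fin k) (pos : Fin k → ℤ) (a b : Fin k) : Prop :=
  ∀ x ∈ V, ∀ y ∈ V, ∀ z ∈ V, y < M → a ≤ x → x < b → a ≤ z → z < b →
    pos x < pos y → pos y < pos z → a ≤ y ∧ y < b

/-- If two blocks overlap, then their intersection, their differences and their union are blocks. -/
theorem IsBlock.of_crossing {V : Finset (Fin k)} {M : Fin k} {pos : Fin k → ℤ}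
    (hinj : ∀ x ∈ V, ∀ y ∈ V, x < M → y < M → pos x = pos y → x = y) {a b c d : Fin k}
    (hb : b ∈ V) (hc : c ∈ V) (hab : a < b) (hbc : b < c) (hcd : c < d) (hdM : d ≤ M)
    (ha : a ∈ V)
    (hac : IsBlock V M pos a c) (hbd : IsBlock V M pos b d) :
    IsBlock V M pos a b ∧ IsBlock V M pos b c ∧ IsBlock V M pos c d ∧ IsBlock V M pos a d := by
  have tri : ∀ x ∈ V, ∀ y ∈ V, x < M → y < M → x ≠ y → pos x < pos y ∨ pos y < pos x :=
    fun x hx y hy hxM hyM hxy => lt_or_gt_of_ne fun h => hxy (hinj x hx y hy hxM hyM h)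
  refine ⟨?_, ?_, ?_, ?_⟩
  · intro x hx y hy z hz hyM h1 h2 h3 h4 h5 h6
    have h7 := hac x hx y hy z hz hyM h1 (by order) h3 (by order) h5 h6
    refine ⟨h7.1, ?_⟩
    by_contra! h8
    rcases tri c hc y hy (by order) hyM (by order) with h | h
    · rcases tri c hc x hx (by order) (by order) (by order) with h' | h'
      · have := hbd c hc x hx y hy (by order) (by order) (by order) (by order) (by order) h' h5
        order
      · have := hac x hx c hc y hy (by order) (by order) (by order) (by order) (by order) h' h
        order
    · rcases tri c hc z hz (by order) (by order) (by order) with h' | h'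
      · have := hac y hy c hc z hz (by order) (by order) (by order) (by order) (by order) h h'
        order
      · have := hbd y hy z hz c hc (by order) (by order) (by order) (by order) (by order) h6 h'
        order
  · intro x hx y hy z hz hyM h1 h2 h3 h4 h5 h6
    have h7 := hac x hx y hy z hz hyM (by order) (by order) (by order) (by order) h5 h6
    have h8 := hbd x hx y hy z hz hyM (by order) (by order) (by order) (by order) h5 h6
    exact ⟨h8.1, h7.2⟩
  · intro x hx y hy z hz hyM h1 h2 h3 h4 h5 h6
    have h7 := hbd x hx y hy z hz hyM (by order) h2 (by order) h4 h5 h6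
    refine ⟨?_, h7.2⟩
    by_contra! h8
    rcases tri a ha y hy (by order) hyM (by order) with h | h
    · rcases tri a ha x hx (by order) (by order) (by order) with h' | h'
      · have := hac a ha x hx y hy (by order) (by order) (by order) (by order) (by order) h' h5
        order
      · have := hbd x hx a ha y hy (by order) (by order) (by order) (by order) (by order) h' h
        order
    · rcases tri a ha z hz (by order) (by order) (by order) with h' | h'
      · have := hbd y hy a ha z hz (by order) (by order) (by order) (by order) (by order) h h'
        order
      · have := hac y hy z hz a ha (by order) (by order) (by order) (by order) (by order) h6 h'
        order
  · intro x hx y hy z hz hyM h1 h2 h3 h4 h5 h6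
    by_contra h7
    have hyb : y ≠ b := by rintro rfl; exact h7 ⟨hab.le, by order⟩
    have h8 : ¬ (a ≤ y ∧ y < c) := fun h => h7 ⟨h.1, by order⟩
    have h9 : ¬ (b ≤ y ∧ y < d) := fun h => h7 ⟨by order, h.2⟩
    rcases tri b hb y hy (by order) hyM hyb.symm with h | h
    · rcases lt_or_ge z c with h' | h'
      · exact h8 (hac b hb y hy z hz hyM (by order) (by order) (by order) (by order) h h6)
      · exact h9 (hbd b hb y hy z hz hyM (by order) (by order) (by order) (by order) h h6)
    · rcases lt_or_ge x c with h' | h'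
      · exact h8 (hac x hx y hy b hb hyM (by order) (by order) (by order) (by order) h5 h)
      · exact h9 (hbd x hx y hy b hb hyM (by order) (by order) (by order) (by order) h5 h)

/-- A letter outside a block lies on the same side of all the members of the block. -/
theorem IsBlock.same_side {V : Finset (Fin k)} {M : Fin k} {pos : Fin k → ℤ}
    (hinj : ∀ x ∈ V, ∀ y ∈ V, x < M → y < M → pos x = pos y → x = y) {a b : Fin k}
    (h : IsBlock V M pos a b) (hbM : b ≤ M) {x y w : Fin k} (hx : x ∈ V) (hy : y ∈ V) (hw : w ∈ V)
    (hwM : w < M) (hax : a ≤ x) (hxb : x < b) (hay : a ≤ y) (hyb : y < b)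
    (hwab : ¬ (a ≤ w ∧ w < b)) :
    (pos x < pos w → pos y < pos w) ∧ (pos w < pos x → pos w < pos y) := by
  have hne : pos y ≠ pos w := by
    intro e
    have := hinj y hy w hw (by order) hwM e
    subst this
    exact hwab ⟨hay, hyb⟩
  constructor <;> intro h1 <;> by_contra! h2
  · exact hwab (h x hx w hw y hy hwM hax hxb hay hyb h1 (lt_of_le_of_ne h2 hne.symm))
  · exact hwab (h y hy w hw x hx hwM hay hyb hax hxb (lt_of_le_of_ne h2 hne) h1)

/-- Of three blocks whose union is convex, two have a convex union if the third does not lie between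
them, which can be tested on one member `p`, `q`, `r` of each of them. -/
theorem IsBlock.union {V : Finset (Fin k)} {M : Fin k} {pos : Fin k → ℤ}
    (hinj : ∀ x ∈ V, ∀ y ∈ V, x < M → y < M → pos x = pos y → x = y) {a b c d a' b' c' d' : Fin k}
    (h₁ : IsBlock V M pos a b) (h₂ : IsBlock V M pos c d) (h₃ : IsBlock V M pos a' b')
    (hbM : b ≤ M) (hdM : d ≤ M) (hbM' : b' ≤ M)
    (h₁₃ : ∀ x, a ≤ x ∧ x < b → ¬ (a' ≤ x ∧ x < b'))
    (h₂₃ : ∀ x, c ≤ x ∧ x < d → ¬ (a' ≤ x ∧ x < b'))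
    (hu : ∀ x, c' ≤ x ∧ x < d' ↔ (a ≤ x ∧ x < b) ∨ (c ≤ x ∧ x < d))
    {p q r : Fin k} (hp : p ∈ V) (hq : q ∈ V) (hr : r ∈ V)
    (hp' : a ≤ p ∧ p < b) (hq' : c ≤ q ∧ q < d) (hr' : a' ≤ r ∧ r < b')
    (hn : ¬ (pos p < pos r ∧ pos r < pos q)) (hn' : ¬ (pos q < pos r ∧ pos r < pos p))
    (h : ∀ x ∈ V, ∀ y ∈ V, ∀ z ∈ V, y < M → c' ≤ x → x < d' → c' ≤ z → z < d' →
      pos x < pos y → pos y < pos z → (c' ≤ y ∧ y < d') ∨ (a' ≤ y ∧ y < b')) :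
    IsBlock V M pos c' d' := by
  have s₁ := fun {x y w} hx hy hw hwM (hx' : a ≤ x ∧ x < b) (hy' : a ≤ y ∧ y < b) hwab =>
    h₁.same_side hinj hbM (x := x) (y := y) (w := w) hx hy hw hwM hx'.1 hx'.2 hy'.1 hy'.2 hwab
  have s₂ := fun {x y w} hx hy hw hwM (hx' : c ≤ x ∧ x < d) (hy' : c ≤ y ∧ y < d) hwab =>
    h₂.same_side hinj hdM (x := x) (y := y) (w := w) hx hy hw hwM hx'.1 hx'.2 hy'.1 hy'.2 hwab
  have s₃ := fun {x y w} hx hy hw hwM (hx' : a' ≤ x ∧ x < b') (hy' : a' ≤ y ∧ y < b') hwab =>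
    h₃.same_side hinj hbM' (x := x) (y := y) (w := w) hx hy hw hwM hx'.1 hx'.2 hy'.1 hy'.2 hwab
  intro x hx y hy z hz hyM h1 h2 h3 h4 h5 h6
  refine (h x hx y hy z hz hyM h1 h2 h3 h4 h5 h6).resolve_right fun h7 => ?_
  have hpM : p < M := by order
  have hqM : q < M := by order
  have n1 := fun hw => h₁₃ y hw h7
  have n2 := fun hw => h₂₃ y hw h7
  have n3 := h₁₃ p hp'
  have n4 := h₂₃ q hq'
  rcases (hu x).1 ⟨h1, h2⟩ with hx' | hx' <;> rcases (hu z).1 ⟨h3, h4⟩ with hz' | hz'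
  · exact n1 (h₁ x hx y hy z hz hyM hx'.1 hx'.2 hz'.1 hz'.2 h5 h6)
  · have e1 := (s₁ hx hp hy hyM hx' hp' n1).1 h5
    have e2 := (s₂ hz hq hy hyM hz' hq' n2).2 h6
    exact hn ⟨(s₃ hy hr hp hpM h7 hr' n3).2 e1, (s₃ hy hr hq hqM h7 hr' n4).1 e2⟩
  · have e1 := (s₂ hx hq hy hyM hx' hq' n2).1 h5
    have e2 := (s₁ hz hp hy hyM hz' hp' n1).2 h6
    exact hn' ⟨(s₃ hy hr hq hqM h7 hr' n4).2 e1, (s₃ hy hr hp hpM h7 hr' n3).1 e2⟩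
  · exact n2 (h₂ x hx y hy z hz hyM hx'.1 hx'.2 hz'.1 hz'.2 h5 h6)

/-- Three consecutive intervals that are blocks, arranged in a row, occur in such an order that the
middle interval is next to one of the other two. -/
theorem IsBlock.union_of_three {V : Finset (Fin k)} {M : Fin k} {pos : Fin k → ℤ}
    (hinj : ∀ x ∈ V, ∀ y ∈ V, x < M → y < M → pos x = pos y → x = y) {a b c d : Fin k}
    (ha : a ∈ V) (hb : b ∈ V) (hc : c ∈ V) (hab : a < b) (hbc : b < c) (hcd : c < d) (hdM : d ≤ M)
    (h₁ : IsBlock V M pos a b) (h₂ : IsBlock V M pos b c) (h₃ : IsBlock V M pos c d)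
    (h : IsBlock V M pos a d) :
    IsBlock V M pos a c ∨ IsBlock V M pos b d := by
  by_cases hn : (pos a < pos c ∧ pos c < pos b) ∨ (pos b < pos c ∧ pos c < pos a)
  · refine Or.inr (IsBlock.union hinj h₂ h₃ h₁ (by order) (by order) (by order) (by grind)
      (by grind) (by grind) hb hc ha ⟨le_rfl, hbc⟩ ⟨le_rfl, hcd⟩ ⟨le_rfl, hab⟩ (by omega)
      (by omega) ?_)
    intro x hx y hy z hz hyM h1 h2 h3 h4 h5 h6
    have h7 := h x hx y hy z hz hyM (by order) (by order) (by order) (by order) h5 h6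
    grind
  · refine Or.inl (IsBlock.union hinj h₁ h₂ h₃ (by order) (by order) (by order) (by grind)
      (by grind) (by grind) ha hb hc ⟨le_rfl, hab⟩ ⟨le_rfl, hbc⟩ ⟨le_rfl, hcd⟩ (by omega)
      (by omega) ?_)
    intro x hx y hy z hz hyM h1 h2 h3 h4 h5 h6
    have h7 := h x hx y hy z hz hyM (by order) (by order) (by order) (by order) h5 h6
    grind

theorem isContiguous_iff_isBlock (π : Equiv.Perm (Fin (k - 1))) {pos : Fin k → ℤ} {M : Fin k}
    (hM : M.val = k - 1)
    (hpos : ∀ x y : Fin (k - 1), π.symm x < π.symm y ↔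
      pos (x.castLE (Nat.sub_le k 1)) < pos (y.castLE (Nat.sub_le k 1))) {i j : Fin k}
    (hij : i < j) : IsContiguous π i j ↔ IsBlock Finset.univ M pos i j := by
  have hlift : ∀ x : Fin k, x < M → ∃ x' : Fin (k - 1), x'.castLE (Nat.sub_le k 1) = x :=
    fun x hx => ⟨⟨x.val, by rw [← hM]; exact hx⟩, rfl⟩
  have hjM : j ≤ M := by rw [Fin.le_def, hM]; omega
  constructor
  · rintro ⟨a, ha⟩
    have hmem : ∀ m : Fin (k - 1), (a ≤ (π.symm m).val ∧ (π.symm m).val < a + (j - i)) ↔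
        (i.val ≤ m.val ∧ m.val < j.val) := by
      intro m
      have := Set.ext_iff.1 ha m
      refine Iff.trans ?_ this
      constructor
      · intro h; exact ⟨π.symm m, h, by simp⟩
      · rintro ⟨t, ht, rfl⟩; simpa using ht
    intro x _ y _ z _ hyM h1 h2 h3 h4 h5 h6
    obtain ⟨x, rfl⟩ := hlift x (by order)
    obtain ⟨y, rfl⟩ := hlift y hyM
    obtain ⟨z, rfl⟩ := hlift z (by order)
    rw [← hpos] at h5 h6
    have hx := (hmem x).2 ⟨h1, h2⟩
    have hz := (hmem z).2 ⟨h3, h4⟩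
    have hy := (hmem y).1 ⟨by have := Fin.lt_def.1 h5; omega, by have := Fin.lt_def.1 h6; omega⟩
    exact ⟨hy.1, hy.2⟩
  · intro hB
    -- The set of the positions of the letters from `i` to `j`; it is an interval.
    set T : Finset (Fin (k - 1)) :=
      ((Finset.Ico i.val j.val).attachFin (fun m hm => by
        have := (Finset.mem_Ico.1 hm).2; omega)).map π.symm.toEmbedding with hT
    have hmem : ∀ t, t ∈ T ↔ i.val ≤ (π t).val ∧ (π t).val < j.val := by
      intro t
      simp only [hT, Finset.mem_map, Finset.mem_attachFin, Finset.mem_Ico]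
      constructor
      · rintro ⟨m, hm, rfl⟩; simpa using hm
      · intro h; exact ⟨π t, h, by simp⟩
    have hcard : T.card = j - i := by simp [hT]
    have hne : T.Nonempty := Finset.card_pos.1 (by rw [hcard]; have := Fin.lt_def.1 hij; omega)
    have hIcc : T = Finset.Icc (T.min' hne) (T.max' hne) := by
      ext t
      rw [Finset.mem_Icc]
      refine ⟨fun h => ⟨T.min'_le t h, T.le_max' t h⟩, fun ⟨h1, h2⟩ => ?_⟩
      rcases h1.eq_or_lt with h1 | h1
      · rw [← h1]; exact T.min'_mem hne
      rcases h2.eq_or_lt with h2 | h2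
      · rw [h2]; exact T.max'_mem hne
      have m1 := (hmem _).1 (T.min'_mem hne)
      have m2 := (hmem _).1 (T.max'_mem hne)
      rw [hmem]
      refine hB ((π (T.min' hne)).castLE (Nat.sub_le k 1)) (Finset.mem_univ _)
        ((π t).castLE (Nat.sub_le k 1)) (Finset.mem_univ _)
        ((π (T.max' hne)).castLE (Nat.sub_le k 1)) (Finset.mem_univ _) ?_ m1.1 m1.2 m2.1 m2.2
        ((hpos _ _).1 (by simpa using h1)) ((hpos _ _).1 (by simpa using h2))
      rw [Fin.lt_def, hM]; exact (π t).isLt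
    have hc2 : (T.max' hne).val + 1 - (T.min' hne).val = j - i := by
      rw [← hcard, ← Fin.card_Icc, ← hIcc]
    refine ⟨(T.min' hne).val, ?_⟩
    ext m
    simp only [Set.mem_image, Set.mem_ofPred_eq]
    have key : ∀ t, ((T.min' hne).val ≤ t.val ∧ t.val < (T.min' hne).val + (j - i)) ↔ t ∈ T := by
      intro t
      have h1 : t ∈ T ↔ t ∈ Finset.Icc (T.min' hne) (T.max' hne) := by rw [← hIcc]
      rw [h1, Finset.mem_Icc, Fin.le_def, Fin.le_def]
      have := Fin.lt_def.1 hij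
      omega
    constructor
    · rintro ⟨t, ht, rfl⟩
      exact (hmem t).1 ((key t).1 ht)
    · intro h
      exact ⟨π.symm m, (key _).2 ((hmem _).2 (by simpa using h)), by simp⟩

/-! ### The dissection of a permutation graph -/

theorem permGraph_adj_iff (π : Equiv.Perm (Fin (k - 1))) {u v : Fin k} (huv : u < v) :
    (permGraph π).Adj u v ↔ IsContiguous π u v :=
  ⟨fun h => (h.resolve_right fun h' => absurd (huv.trans h'.1) (lt_irrefl _)).2,
    fun h => Or.inl ⟨huv, h⟩⟩

theorem exists_isBlock_iff_permGraph_adj (hk : 0 < k) (π : Equiv.Perm (Fin (k - 1))) :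
    ∃ (pos : Fin k → ℤ) (M : Fin k), (∀ x, x ≤ M) ∧
      (∀ x ∈ (Finset.univ : Finset (Fin k)), ∀ y ∈ (Finset.univ : Finset (Fin k)),
        x < M → y < M → pos x = pos y → x = y) ∧
      ∀ u v, u < v → ((permGraph π).Adj u v ↔ IsBlock Finset.univ M pos u v) := by
  refine ⟨fun x => if h : x.val < k - 1 then ((π.symm ⟨x, h⟩).val : ℤ) else 0,
    ⟨k - 1, by omega⟩, fun x => by rw [Fin.le_def]; simp only; omega, ?_, fun u v huv => ?_⟩
  · intro x _ y _ hx hy h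
    have hx' : x.val < k - 1 := hx
    have hy' : y.val < k - 1 := hy
    simp only [hx', hy', dif_pos, Nat.cast_inj] at h
    have := π.symm.injective (Fin.val_injective h)
    exact Fin.ext (Fin.mk.inj_iff.1 this)
  · rw [permGraph_adj_iff π huv, ← isContiguous_iff_isBlock π rfl _ huv]
    intro x y
    simp only [Fin.val_castLE, x.isLt, y.isLt, dif_pos, Nat.cast_lt, Fin.val_fin_lt, Fin.eta]

theorem isBlock_of_boundary {V : Finset (Fin k)} {M : Fin k} (hM : M ∈ V) (hVM : ∀ x ∈ V, x ≤ M)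
    (pos : Fin k → ℤ) {u v : Fin k} (huv : u < v) (h : (boundary V).Adj u v) :
    IsBlock V M pos u v := by
  obtain ⟨-, -, hv, h | h⟩ := boundary_adj_iff.1 h
  · intro x hx y hy z hz hyM h1 h2 h3 h4 h5 h6
    have hx := h x hx
    have hz := h z hz
    have : x = z := by unfold Between at *; grind
    subst this
    omega
  · intro x hx y hy z hz hyM h1 h2 h3 h4 h5 h6
    have hy := h y hy
    have hM' := h M hM
    have := hVM v hv
    unfold Outside at *; grind

theorem permGraph_adj_of_boundary (π : Equiv.Perm (Fin (k - 1))) {u v : Fin k}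
    (h : (boundary Finset.univ).Adj u v) : (permGraph π).Adj u v := by
  wlog huv : u < v generalizing u v
  · exact (this h.symm (lt_of_le_of_ne (not_lt.1 huv) h.ne.symm)).symm
  obtain ⟨pos, M, hM, hinj, hadj⟩ := exists_isBlock_iff_permGraph_adj u.pos π
  rw [hadj u v huv]
  exact isBlock_of_boundary (Finset.mem_univ M) (fun x _ => hM x) pos huv h

theorem permGraph_isCrossClosed (π : Equiv.Perm (Fin (k - 1))) : IsCrossClosed (permGraph π) := by
  have key : ∀ a b c d : Fin k, a < b → b < c → c < d → (permGraph π).Adj a c →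
      (permGraph π).Adj b d → (permGraph π).Adj a b ∧ (permGraph π).Adj b c ∧
        (permGraph π).Adj c d ∧ (permGraph π).Adj a d := by
    intro a b c d hab hbc hcd hac hbd
    obtain ⟨pos, M, hM, hinj, hadj⟩ := exists_isBlock_iff_permGraph_adj a.pos π
    rw [hadj _ _ (hab.trans hbc)] at hac
    rw [hadj _ _ (hbc.trans hcd)] at hbd
    rw [hadj _ _ hab, hadj _ _ hbc, hadj _ _ hcd, hadj _ _ (hab.trans (hbc.trans hcd))]
    exact hac.of_crossing hinj (Finset.mem_univ _) (Finset.mem_univ _) hab hbc hcd (hM d)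
      (Finset.mem_univ _) hbd
  intro u v x y huv hxy h
  unfold Interleaves Between Outside at h
  rcases h with ⟨h | h, h' | h'⟩ | ⟨h | h, h' | h'⟩
  · exact (key y u x v h'.1 h.1 h.2 hxy.symm huv).2.1
  · exact (key u x v y h.1 h.2 h'.2 huv hxy).1
  · exact (key y v x u h'.2 h.1 h.2 hxy.symm huv.symm).2.2.1.symm
  · exact (key v x u y h.1 h.2 h'.1 huv.symm hxy).2.1.symm
  · exact (key x u y v h'.1 h.1 h.2 hxy huv).1.symm
  · exact (key u y v x h.1 h.2 h'.2 huv hxy.symm).2.2.2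
  · exact (key x v y u h'.2 h.1 h.2 hxy huv.symm).2.2.2.symm
  · exact (key v y u x h.1 h.2 h'.1 huv.symm hxy.symm).2.2.1

/-- A region with four vertices is never left as a bare cycle. -/
theorem permGraph_exists_diagonal (π : Equiv.Perm (Fin (k - 1))) {R : Finset (Fin k)}
    (hR : R.card = 4) (h : ∀ u v, (boundary R).Adj u v → (permGraph π).Adj u v) :
    ∃ u ∈ R, ∃ v ∈ R, (permGraph π).Adj u v ∧ ¬ (boundary R).Adj u v := by
  have hmono := (R.orderEmbOfFin hR).strictMono
  have hrange : ∀ w ∈ R, ∃ i, R.orderEmbOfFin hR i = w := fun w hw => by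
    have : w ∈ Set.range (R.orderEmbOfFin hR) := by rwa [Finset.range_orderEmbOfFin]
    exact this
  have hmem := R.orderEmbOfFin_mem hR
  generalize R.orderEmbOfFin hR = f at hmono hrange hmem
  have h01 := hmono (show (0 : Fin 4) < 1 by decide)
  have h12 := hmono (show (1 : Fin 4) < 2 by decide)
  have h23 := hmono (show (2 : Fin 4) < 3 by decide)
  have hall : ∀ w ∈ R, w = f 0 ∨ w = f 1 ∨ w = f 2 ∨ w = f 3 := by
    intro w hw
    obtain ⟨i, rfl⟩ := hrange w hw
    fin_cases i <;> simp
  obtain ⟨pos, M, hM, hinj, hadj⟩ := exists_isBlock_iff_permGraph_adj (f 0).pos π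
  have b01 := h (f 0) (f 1) (boundary_adj_iff.2 ⟨h01.ne, hmem _, hmem _, by
    left; unfold Between; grind⟩)
  have b12 := h (f 1) (f 2) (boundary_adj_iff.2 ⟨h12.ne, hmem _, hmem _, by
    left; unfold Between; grind⟩)
  have b23 := h (f 2) (f 3) (boundary_adj_iff.2 ⟨h23.ne, hmem _, hmem _, by
    left; unfold Between; grind⟩)
  have b03 := h (f 0) (f 3) (boundary_adj_iff.2 ⟨(h01.trans (h12.trans h23)).ne, hmem _, hmem _, by
    right; unfold Outside; grind⟩)
  rw [hadj _ _ h01] at b01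
  rw [hadj _ _ h12] at b12
  rw [hadj _ _ h23] at b23
  rw [hadj _ _ (h01.trans (h12.trans h23))] at b03
  rcases IsBlock.union_of_three hinj (Finset.mem_univ _) (Finset.mem_univ _) (Finset.mem_univ _)
    h01 h12 h23 (hM _) b01 b12 b23 b03 with hb | hb
  · refine ⟨f 0, hmem _, f 2, hmem _, (hadj _ _ (h01.trans h12)).2 hb, fun hbd => ?_⟩
    obtain ⟨-, -, -, h' | h'⟩ := boundary_adj_iff.1 hbd
    · exact h' _ (hmem 1) (Or.inl ⟨h01, h12⟩)
    · exact h' _ (hmem 3) (Or.inr ⟨h01.trans (h12.trans h23), h23⟩)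
  · refine ⟨f 1, hmem _, f 3, hmem _, (hadj _ _ (h12.trans h23)).2 hb, fun hbd => ?_⟩
    obtain ⟨-, -, -, h' | h'⟩ := boundary_adj_iff.1 hbd
    · exact h' _ (hmem 2) (Or.inl ⟨h12, h23⟩)
    · exact h' _ (hmem 0) (Or.inl ⟨h01, h01.trans (h12.trans h23)⟩)

/-- An edge of `G` that is a diagonal of a region is crossed by another edge, so that it lies in a
maximal clique with at least three vertices. This clique is a region, hence the given one. -/
theorem IsCrossClosed.adj_of_diagonal {G D : SimpleGraph (Fin k)} (hG : IsCrossClosed G)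
    (hD : ∀ u v, D.Adj u v ↔ G.Adj u v ∧ ¬ (boundary Finset.univ).Adj u v ∧
      ∀ x y, G.Adj x y → ¬ Interleaves u v x y) {R : Finset (Fin k)} (hR : IsRegion D R)
    {u v : Fin k} (hu : u ∈ R) (hv : v ∈ R) (huv : G.Adj u v) (hb : ¬ (boundary R).Adj u v) :
    ∀ a ∈ R, ∀ b ∈ R, a ≠ b → G.Adj a b := by
  have hDn : IsNoncrossing D := fun u v x y h h' => ((hD u v).1 h).2.2 x y ((hD x y).1 h').1
  have : ∃ x y, G.Adj x y ∧ Interleaves u v x y := by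
    by_contra! h
    refine hb (hR.undivided u hu v hv ((hD u v).2 ⟨huv, fun h' => hb ?_, h⟩))
    exact boundary_of_subset (Finset.subset_univ _) hu hv h'
  obtain ⟨x, y, hxy, hi⟩ := this
  have hux := hG _ _ _ _ huv hxy hi
  have hvx := hG _ _ _ _ huv.symm hxy hi.swap_left
  obtain ⟨C, hSC, hC, hcl⟩ := hG.exists_clique_region hD (S := {u, v, x})
    (by rw [Finset.card_eq_three.2 ⟨u, v, x, huv.ne, hux.ne, hvx.ne, rfl⟩]) (by
      intro a ha b hb hab
      simp only [Finset.mem_insert, Finset.mem_singleton] at ha hb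
      rcases ha with rfl | rfl | rfl <;> rcases hb with rfl | rfl | rfl <;>
        first | exact absurd rfl hab | assumption | (apply SimpleGraph.Adj.symm; assumption))
  have hRC := hR.subset hDn hC huv.ne hu hv (hSC (by simp)) (hSC (by simp)) hb
  exact fun a ha b hb => hcl a (hRC ha) b (hRC hb)

theorem permGraph_dissection {A : Fin k → EuclideanSpace ℝ (Fin 2)} (hA : IsConvexPolygon A)
    (π : Equiv.Perm (Fin (k - 1))) :
      IsDissection A (noncrossingDiagonals A (permGraph π)) ∧
      (∀ R, IsRegion (noncrossingDiagonals A (permGraph π)) R →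
        (R.card ≠ 4 ∧
          ∀ u ∈ R, ∀ v ∈ R, ((permGraph π).Adj u v ↔ (boundary R).Adj u v)) ∨
        (∀ u ∈ R, ∀ v ∈ R, ((permGraph π).Adj u v ↔ (completeOn R).Adj u v))) ∧
      (∀ u v, (permGraph π).Adj u v →
        ∃ R, IsRegion (noncrossingDiagonals A (permGraph π)) R ∧ u ∈ R ∧ v ∈ R) := by
  have hD : ∀ u v, (noncrossingDiagonals A (permGraph π)).Adj u v ↔ (permGraph π).Adj u v ∧
      ¬ (boundary Finset.univ).Adj u v ∧
      ∀ x y, (permGraph π).Adj x y → ¬ Interleaves u v x y := by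
    intro u v
    refine and_congr_right fun huv => and_congr_right fun _ => forall_congr' fun x =>
      forall_congr' fun y => ?_
    exact ⟨fun h hxy h' => h hxy ((crosses_iff_interleaves hA huv.ne hxy.ne).2 h'),
      fun h hxy h' => h hxy ((crosses_iff_interleaves hA huv.ne hxy.ne).1 h')⟩
  refine ⟨⟨fun u v h => h.2.1, fun u v x y h h' => h.2.2 x y h'.1⟩, fun R hR => ?_,
    fun u v huv => ?_⟩
  · have hbd : ∀ u v, (boundary R).Adj u v → (permGraph π).Adj u v := fun u v h =>
      (hR.sides u v h).elim (permGraph_adj_of_boundary π) (fun h => h.1)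
    by_cases hdiag : ∃ u ∈ R, ∃ v ∈ R, (permGraph π).Adj u v ∧ ¬ (boundary R).Adj u v
    · obtain ⟨u, hu, v, hv, huv, hb⟩ := hdiag
      have hall := (permGraph_isCrossClosed π).adj_of_diagonal hD hR hu hv huv hb
      exact Or.inr fun a ha b hb =>
        ⟨fun h => ⟨h.ne, ha, hb⟩, fun h => hall a ha b hb h.1⟩
    · refine Or.inl ⟨fun h4 => hdiag (permGraph_exists_diagonal π h4 hbd), fun u hu v hv =>
        ⟨fun h => ?_, hbd u v⟩⟩
      by_contra hb
      exact hdiag ⟨u, hu, v, hv, h, hb⟩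
  · exact exists_region hA.1 fun p q hpq h =>
      ((hD p q).1 hpq).2.2 u v huv h.symm

/-! ### Inflation of a letter -/

/-- The positions obtained from `f` by replacing the single letter `i` with the set of letters `B`,
placed where `i` was and arranged within according to `g`. -/
theorem exists_inflation (f g : Fin k → ℤ) (B : Fin k → Prop) (i : Fin k) :
    ∃ pos : Fin k → ℤ, (∀ x y, B x → B y → (pos x < pos y ↔ g x < g y)) ∧
      (∀ x y, ¬ B x → ¬ B y → (pos x < pos y ↔ f x < f y)) ∧
      (∀ x y, B x → ¬ B y → f i ≠ f y →
        ((pos x < pos y ↔ f i < f y) ∧ (pos y < pos x ↔ f y < f i))) := by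
  classical
  -- Positions of `f` are stretched by `2 * b + 1`, which leaves room for the values of `g` around
  -- `f i`.
  set b : ℤ := ∑ x, |g x| with hb
  have hgb : ∀ x, |g x| ≤ b := fun x =>
    Finset.single_le_sum (f := fun x => |g x|) (fun _ _ => abs_nonneg _) (Finset.mem_univ x)
  have hb0 : 0 ≤ b := (abs_nonneg _).trans (hgb i)
  have scale : ∀ m n : ℤ, m < n → m * (2 * b + 1) + (2 * b + 1) ≤ n * (2 * b + 1) :=
    fun m n h => by nlinarith
  have scale' : ∀ m n : ℤ, m * (2 * b + 1) < n * (2 * b + 1) ↔ m < n :=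
    fun m n => mul_lt_mul_iff_left₀ (by omega)
  refine ⟨fun x => if B x then f i * (2 * b + 1) + g x else f x * (2 * b + 1), ?_, ?_, ?_⟩
  · intro x y hx hy
    simp [hx, hy]
  · intro x y hx hy
    simp only [hx, hy, if_false, scale']
  · intro x y hx hy hne
    simp only [hx, hy, if_true, if_false]
    have := abs_le.1 (hgb x)
    rcases lt_or_gt_of_ne hne with h | h
    · have := scale _ _ h
      constructor <;> constructor <;> intro <;> omega
    · have := scale _ _ h
      constructor <;> constructor <;> intro <;> omega

theorem IsBlock.neg_iff {V : Finset (Fin k)} {M : Fin k} {pos : Fin k → ℤ} {a b : Fin k} :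
    IsBlock V M (-pos) a b ↔ IsBlock V M pos a b := by
  have : ∀ p : Fin k → ℤ, IsBlock V M p a b → IsBlock V M (-p) a b :=
    fun p h x hx y hy z hz hyM h1 h2 h3 h4 h5 h6 =>
      h z hz y hy x hx hyM h3 h4 h1 h2 (neg_lt_neg_iff.1 h6) (neg_lt_neg_iff.1 h5)
  exact ⟨fun h => neg_neg pos ▸ this _ h, this _⟩

/-- In the arrangement `f`, the letter `i` (which is to be replaced with the letters from `i` to
`j`) is joined in ascending order to the letters just below it or to those just above it. Only a
consequence of this is recorded: either the last letter `l < i` is placed before `i` with nothing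
but letters below `i` between them, or the letter `j` is placed after `i` with nothing but letters
above `i` between them. -/
def Ascends (V : Finset (Fin k)) (M i j : Fin k) (f : Fin k → ℤ) : Prop :=
  (∃ l ∈ V, l < i ∧ (∀ y ∈ V, y < i → y ≤ l) ∧ f l < f i ∧
    ∀ y ∈ V, ¬ (i ≤ y ∧ y < j) → y < M → f l < f y → f y < f i → y < i) ∨
  (j < M ∧ f i < f j ∧
    ∀ y ∈ V, ¬ (i ≤ y ∧ y < j) → y < M → f i < f y → f y < f j → i < y)

/-- The letter `i` is not joined to its neighbours both in ascending and in descending order. -/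
theorem Ascends.not_neg {V : Finset (Fin k)} {M i j : Fin k} (hj : j ∈ V) (hij : i < j)
    (hjM : j ≤ M) {f : Fin k → ℤ}
    (hf : ∀ x ∈ V, x < i → j < M → f x ≠ f j) (h : Ascends V M i j f) :
    ¬ Ascends V M i j (-f) := by
  have key : ∀ f : Fin k → ℤ, (∀ x ∈ V, x < i → j < M → f x ≠ f j) →
      (∃ l ∈ V, l < i ∧ (∀ y ∈ V, y < i → y ≤ l) ∧ f l < f i ∧
        ∀ y ∈ V, ¬ (i ≤ y ∧ y < j) → y < M → f l < f y → f y < f i → y < i) →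
      (j < M ∧ f j < f i ∧
        ∀ y ∈ V, ¬ (i ≤ y ∧ y < j) → y < M → f j < f y → f y < f i → i < y) → False := by
    rintro f hf ⟨l, hl, hli, -, h1, h2⟩ ⟨h3, h4, h5⟩
    rcases lt_trichotomy (f l) (f j) with h | h | h
    · have := h2 j hj (by simp) h3 h h4
      order
    · exact hf l hl hli h3 h
    · have := h5 l hl (by grind) (by order) h h1
      order
  intro h'
  simp only [Ascends, Pi.neg_apply, neg_lt_neg_iff] at h'
  rcases h with h | h <;> rcases h' with h' | h'
  · obtain ⟨l, hl, hli, hmax, h1, -⟩ := h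
    obtain ⟨l', hl', hli', hmax', h1', -⟩ := h'
    have : l = l' := le_antisymm (hmax' l hl hli) (hmax l' hl' hli')
    subst this
    omega
  · exact key f hf h ⟨h'.1, h'.2.1, fun y hy hyB hyM h1 h2 => h'.2.2 y hy hyB hyM h2 h1⟩
  · refine key (-f) (fun x hx hxi hjM e => hf x hx hxi hjM (neg_injective e)) ?_ ?_
    · simpa only [Pi.neg_apply, neg_lt_neg_iff] using h'
    · simp only [Pi.neg_apply, neg_lt_neg_iff]
      exact ⟨h.1, h.2.1, fun y hy hyB hyM h1 h2 => h.2.2 y hy hyB hyM h2 h1⟩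
  · omega

/-- Gluing along a diagonal `i j`. The letter `i` of the outer arrangement `f` is inflated by the
inner arrangement `g` or its reverse. The blocks of the result are those of `f` and `g`, and the
choice between `g` and its reverse ensures that no block overlaps the inserted one. -/
theorem exists_block_inflation {V : Finset (Fin k)} {M i j : Fin k}
    (hVM : ∀ x ∈ V, x ≤ M) (hi : i ∈ V) (hj : j ∈ V) (hij : i < j)
    (hin : ∃ w ∈ V, i < w ∧ w < j) {f g : Fin k → ℤ}
    (hf : ∀ x ∈ V.filter (fun x => ¬ (i < x ∧ x < j)), ∀ y ∈ V.filter (fun x => ¬ (i < x ∧ x < j)),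
      x < M → y < M → f x = f y → x = y)
    (hg : ∀ x ∈ V.filter (fun x => i ≤ x ∧ x ≤ j), ∀ y ∈ V.filter (fun x => i ≤ x ∧ x ≤ j),
      x < j → y < j → g x = g y → x = y) :
    ∃ pos : Fin k → ℤ, (∀ x ∈ V, ∀ y ∈ V, x < M → y < M → pos x = pos y → x = y) ∧
      (∀ a ∈ V, ∀ b ∈ V, i ≤ a → a < b → b ≤ j →
        (IsBlock V M pos a b ↔ IsBlock (V.filter fun x => i ≤ x ∧ x ≤ j) j g a b)) ∧
      (∀ a ∈ V, ∀ b ∈ V, ¬ (i < a ∧ a < j) → ¬ (i < b ∧ b < j) → a < b →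
        (IsBlock V M pos a b ↔ IsBlock (V.filter fun x => ¬ (i < x ∧ x < j)) M f a b)) ∧
      (∀ a ∈ V, ∀ b ∈ V, (a < i ∧ i < b ∧ b < j) ∨ (i < a ∧ a < j ∧ j < b) →
        ¬ IsBlock V M pos a b) := by
  classical
  have hjM := hVM j hj
  simp only [Finset.mem_filter] at hf hg
  -- The block ends with the letter `r`; comparing it with `i` tells in which sense the block might
  -- be cut into two blocks.
  obtain ⟨r, hrV, hir, hrj, hrmax⟩ : ∃ r ∈ V, i < r ∧ r < j ∧ ∀ y ∈ V, y < j → y ≤ r := by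
    obtain ⟨w, hw, hiw, hwj⟩ := hin
    have hn : (V.filter (· < j)).Nonempty := ⟨w, by simp [hw, hwj]⟩
    have hm := Finset.max'_mem _ hn
    have hl := Finset.le_max' (V.filter (· < j))
    simp only [Finset.mem_filter] at hm hl
    exact ⟨_, hm.1, hiw.trans_le (hl w ⟨hw, hwj⟩), hm.2, fun y hy hyj => hl y ⟨hy, hyj⟩⟩
  have hgir : g i ≠ g r := fun e =>
    hir.ne (hg i ⟨hi, le_rfl, hij.le⟩ r ⟨hrV, hir.le, hrj.le⟩ hij hrj e)
  -- The inner arrangement is oriented against the sense in which `i` is joined to its neighbours.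
  obtain ⟨g', hg'inj, hg'B, hg'1, hg'2⟩ : ∃ g' : Fin k → ℤ, (∀ x y, g' x = g' y ↔ g x = g y) ∧
      (∀ W : Finset (Fin k), ∀ m a b, IsBlock W m g' a b ↔ IsBlock W m g a b) ∧
      (Ascends V M i j f → g' r < g' i) ∧ (¬ Ascends V M i j f → g' i < g' r) := by
    by_cases h : Ascends V M i j f <;> rcases lt_or_gt_of_ne hgir with h' | h'
    · exact ⟨-g, by simp, fun W m a b => IsBlock.neg_iff, by simp [h'], by simp [h]⟩
    · exact ⟨g, by simp, fun W m a b => Iff.rfl, by simp [h'], by simp [h]⟩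
    · exact ⟨g, by simp, fun W m a b => Iff.rfl, by simp [h], by simp [h']⟩
    · exact ⟨-g, by simp, fun W m a b => IsBlock.neg_iff, by simp [h], by simp [h']⟩
  obtain ⟨pos, p1, p2, p3⟩ := exists_inflation f g' (fun x => i ≤ x ∧ x < j) i
  have hfi : ∀ y ∈ V, ¬ (i ≤ y ∧ y < j) → y < M → f i ≠ f y := by
    intro y hy hyB hyM e
    have := hf i ⟨hi, by simp⟩ y ⟨hy, by grind⟩ (by order) hyM e
    subst this
    exact hyB ⟨le_rfl, hij⟩
  have q3 : ∀ x y, (i ≤ x ∧ x < j) → y ∈ V → ¬ (i ≤ y ∧ y < j) → y < M →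
      ((pos x < pos y ↔ f i < f y) ∧ (pos y < pos x ↔ f y < f i)) :=
    fun x y hx hy hyB hyM => p3 x y hx hyB (hfi y hy hyB hyM)
  have hinj : ∀ x ∈ V, ∀ y ∈ V, x < M → y < M → pos x = pos y → x = y := by
    intro x hx y hy hxM hyM e
    by_cases hxB : i ≤ x ∧ x < j <;> by_cases hyB : i ≤ y ∧ y < j
    · have h1 := p1 x y hxB hyB
      have h2 := p1 y x hyB hxB
      exact hg x ⟨hx, hxB.1, hxB.2.le⟩ y ⟨hy, hyB.1, hyB.2.le⟩ hxB.2 hyB.2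
        ((hg'inj x y).1 (by omega))
    · have h1 := q3 x y hxB hy hyB hyM
      have h2 := hfi y hy hyB hyM
      omega
    · have h1 := q3 y x hyB hx hxB hxM
      have h2 := hfi x hx hxB hxM
      omega
    · have h1 := p2 x y hxB hyB
      have h2 := p2 y x hyB hxB
      exact hf x ⟨hx, by grind⟩ y ⟨hy, by grind⟩ hxM hyM (by omega)
  have tri : ∀ x ∈ V, ∀ y ∈ V, x < M → y < M → x ≠ y → pos x < pos y ∨ pos y < pos x :=
    fun x hx y hy hxM hyM hxy => lt_or_gt_of_ne fun h => hxy (hinj x hx y hy hxM hyM h)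
  refine ⟨pos, hinj, ?_, ?_, ?_⟩
  · intro a ha b hb hia hab hbj
    rw [← hg'B]
    constructor
    · intro h x hx y hy z hz hyj h1 h2 h3 h4 h5 h6
      rw [Finset.mem_filter] at hx hy hz
      rw [← p1 _ _ ⟨by order, by order⟩ ⟨by grind, by order⟩] at h5 h6
      exact h x hx.1 y hy.1 z hz.1 (by order) h1 h2 h3 h4 h5 h6
    · intro h x hx y hy z hz hyM h1 h2 h3 h4 h5 h6
      have hxB : i ≤ x ∧ x < j := ⟨by order, by order⟩
      have hzB : i ≤ z ∧ z < j := ⟨by order, by order⟩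
      have hyB : i ≤ y ∧ y < j := by
        by_contra hyB
        have := (q3 x y hxB hy hyB hyM).1.1 h5
        have := (q3 z y hzB hy hyB hyM).2.1 h6
        omega
      rw [p1 _ _ hxB hyB] at h5
      rw [p1 _ _ hyB hzB] at h6
      exact h x (by simp [hx, hxB.1, hxB.2.le]) y (by simp [hy, hyB.1, hyB.2.le]) z
        (by simp [hz, hzB.1, hzB.2.le]) hyB.2 h1 h2 h3 h4 h5 h6
  · intro a ha b hb haB hbB hab
    have hbM := hVM b hb
    -- Outside the block, `c` is the identity; it sends the block to its letter `i`.
    obtain ⟨c, hc1, hc2⟩ : ∃ c : Fin k → Fin k, (∀ x, i ≤ x ∧ x < j → c x = i) ∧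
        ∀ x, ¬ (i ≤ x ∧ x < j) → c x = x :=
      ⟨fun x => if i ≤ x ∧ x < j then i else x, fun x h => if_pos h, fun x h => if_neg h⟩
    have hcV : ∀ x ∈ V, c x ∈ V ∧ ¬ (i < c x ∧ c x < j) := by
      intro x hx
      by_cases hxB : i ≤ x ∧ x < j
      · rw [hc1 x hxB]; exact ⟨hi, by simp⟩
      · rw [hc2 x hxB]; exact ⟨hx, by grind⟩
    have hcab : ∀ x, (a ≤ c x ∧ c x < b) ↔ (a ≤ x ∧ x < b) := by
      intro x
      by_cases hxB : i ≤ x ∧ x < j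
      · rw [hc1 x hxB]; grind
      · rw [hc2 x hxB]
    have hcM : ∀ x, x < M → c x < M := by
      intro x hx
      by_cases hxB : i ≤ x ∧ x < j
      · rw [hc1 x hxB]; order
      · rwa [hc2 x hxB]
    have hpc : ∀ x ∈ V, ∀ y ∈ V, x < M → y < M → c x ≠ c y → (pos x < pos y ↔ f (c x) < f (c y)) := by
      intro x hx y hy hxM hyM hne
      by_cases hxB : i ≤ x ∧ x < j <;> by_cases hyB : i ≤ y ∧ y < j
      · exact absurd ((hc1 x hxB).trans (hc1 y hyB).symm) hne
      · rw [hc1 x hxB, hc2 y hyB]; exact (q3 x y hxB hy hyB hyM).1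
      · rw [hc2 x hxB, hc1 y hyB]; exact (q3 y x hyB hx hxB hxM).2
      · rw [hc2 x hxB, hc2 y hyB]; exact p2 x y hxB hyB
    have hcid : ∀ x, ¬ (i < x ∧ x < j) → c x = x := by
      intro x hx
      by_cases hxB : i ≤ x ∧ x < j
      · rw [hc1 x hxB]; grind
      · exact hc2 x hxB
    constructor
    · intro h x hx y hy z hz hyM h1 h2 h3 h4 h5 h6
      rw [Finset.mem_filter] at hx hy hz
      have ex := hcid x hx.2
      have ey := hcid y hy.2
      have ez := hcid z hz.2
      have h5' := (hpc x hx.1 y hy.1 (by order) hyM (by rw [ex, ey]; rintro rfl; omega)).2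
        (by rwa [ex, ey])
      have h6' := (hpc y hy.1 z hz.1 hyM (by order) (by rw [ez, ey]; rintro rfl; omega)).2
        (by rwa [ez, ey])
      exact h x hx.1 y hy.1 z hz.1 hyM h1 h2 h3 h4 h5' h6'
    · intro h x hx y hy z hz hyM h1 h2 h3 h4 h5 h6
      by_contra hyab
      have cx := (hcab x).2 ⟨h1, h2⟩
      have cz := (hcab z).2 ⟨h3, h4⟩
      have cy := fun h => hyab ((hcab y).1 h)
      rw [hpc x hx y hy (by order) hyM (fun e => cy (e ▸ cx))] at h5
      rw [hpc y hy z hz hyM (by order) (fun e => cy (e ▸ cz))] at h6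
      exact cy (h (c x) (by simpa using hcV x hx) (c y) (by simpa using hcV y hy) (c z)
        (by simpa using hcV z hz) (hcM y hyM) cx.1 cx.2 cz.1 cz.2 h5 h6)
  · have hasc : Ascends V M i j f → ¬ Ascends V M i j (-f) := fun h =>
      h.not_neg hj hij hjM fun x hx hxi hjM e => by
        have := hf x ⟨hx, by grind⟩ j ⟨hj, by simp⟩ (by order) (by order) e
        order
    rintro a ha b hb (⟨hai, hib, hbj⟩ | ⟨hia, haj, hjb⟩) h
    -- A block overlapping from below contains `l` and `i` but not `r`, so `i` is placed
    -- between `l` and `r`.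
    · obtain ⟨l, hl, hli, hlmax⟩ : ∃ l ∈ V, l < i ∧ ∀ y ∈ V, y < i → y ≤ l := by
        have hn : (V.filter (· < i)).Nonempty := ⟨a, by simp [ha, hai]⟩
        have hm := Finset.max'_mem _ hn
        have hl := Finset.le_max' (V.filter (· < i))
        simp only [Finset.mem_filter] at hm hl
        exact ⟨_, hm.1, hm.2, fun y hy hyj => hl y ⟨hy, hyj⟩⟩
      have hal := hlmax a ha hai
      have hbr := hrmax b hb hbj
      have hlB : ¬ (i ≤ l ∧ l < j) := by grind
      have n1 := h l hl r hrV i hi (by order) hal (by order) hai.le hib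
      have n2 := h i hi r hrV l hl (by order) hai.le hib hal (by order)
      have li := q3 i l ⟨le_rfl, hij⟩ hl hlB (by order)
      have lr := q3 r l ⟨hir.le, hrj⟩ hl hlB (by order)
      have ir := p1 i r ⟨le_rfl, hij⟩ ⟨hir.le, hrj⟩
      have ri := p1 r i ⟨hir.le, hrj⟩ ⟨le_rfl, hij⟩
      rcases tri l hl i hi (by order) (by order) hli.ne with e | e
      · have hA : Ascends V M i j f := by
          refine Or.inl ⟨l, hl, hli, hlmax, li.2.1 e, fun y hy hyB hyM e1 e2 => ?_⟩
          have := h l hl y hy i hi hyM hal (by order) hai.le hib ((p2 l y hlB hyB).2 e1)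
            ((q3 i y ⟨le_rfl, hij⟩ hy hyB hyM).2.2 e2)
          grind
        have := ri.2 (hg'1 hA)
        have := n1 (lr.2.2 (li.2.1 e)) this
        order
      · have hA : Ascends V M i j (-f) := by
          simp only [Ascends, Pi.neg_apply, neg_lt_neg_iff]
          refine Or.inl ⟨l, hl, hli, hlmax, li.1.1 e, fun y hy hyB hyM e1 e2 => ?_⟩
          have := h i hi y hy l hl hyM hai.le hib hal (by order)
            ((q3 i y ⟨le_rfl, hij⟩ hy hyB hyM).1.2 e2) ((p2 y l hyB hlB).2 e1)
          grind
        have := ir.2 (hg'2 fun hA' => hasc hA' hA)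
        have := n2 this (lr.1.2 (li.1.1 e))
        order
    -- A block overlapping from above contains `r` and `j` but not `i`, so `r` is placed
    -- between `i` and `j`.
    · have hbM := hVM b hb
      have har := hrmax a ha haj
      have hjB : ¬ (i ≤ j ∧ j < j) := by simp
      have hjM' : j < M := by order
      have n1 := h j hj i hi r hrV (by order) haj.le hjb har (by order)
      have n2 := h r hrV i hi j hj (by order) har (by order) haj.le hjb
      have ij := q3 i j ⟨le_rfl, hij⟩ hj hjB hjM'
      have rj := q3 r j ⟨hir.le, hrj⟩ hj hjB hjM'
      have ir := p1 i r ⟨le_rfl, hij⟩ ⟨hir.le, hrj⟩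
      have ri := p1 r i ⟨hir.le, hrj⟩ ⟨le_rfl, hij⟩
      rcases tri i hi j hj (by order) (by order) hij.ne with e | e
      · have hA : Ascends V M i j f := by
          refine Or.inr ⟨hjM', ij.1.1 e, fun y hy hyB hyM e1 e2 => ?_⟩
          have := h r hrV y hy j hj hyM har (by order) haj.le hjb
            ((q3 r y ⟨hir.le, hrj⟩ hy hyB hyM).1.2 e1) ((p2 y j hyB hjB).2 e2)
          grind
        have := ri.2 (hg'1 hA)
        have := n2 this e
        order
      · have hA : Ascends V M i j (-f) := by
          simp only [Ascends, Pi.neg_apply, neg_lt_neg_iff]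
          refine Or.inr ⟨hjM', ij.2.1 e, fun y hy hyB hyM e1 e2 => ?_⟩
          have := h j hj y hy r hrV hyM haj.le hjb har (by order) ((p2 j y hjB hyB).2 e2)
            ((q3 r y ⟨hir.le, hrj⟩ hy hyB hyM).2.2 e1)
          grind
        have := ir.2 (hg'2 fun hA' => hasc hA' hA)
        have := n1 e this
        order

/-! ### Simple arrangements -/

/-- Positions of `0, 1, …, m - 1` in the row `1, 3, 5, …, 0, 4, 6, 8, …, 2`, which is a simple
permutation for every `m ≥ 4`. -/
def simplePos (m n : ℕ) : ℤ :=
  if n % 2 = 1 then n else if n = 2 then 3 * m else m + n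

theorem simplePos_injOn {m a b : ℕ} (ha : a < m) (hb : b < m)
    (h : simplePos m a = simplePos m b) : a = b := by
  unfold simplePos at h
  split_ifs at h <;> omega

/-- An interval with `a > 0` and at least two members has an odd and an even one, and `0` is placed
between them. If `a = 0`, the letter `b`, or the letter `3` when `b = 2`, is placed between two
members. -/
theorem simplePos_not_block {m a b : ℕ} (hm : 4 ≤ m) (hab : a + 2 ≤ b) (hb : b ≤ m)
    (hne : 0 < a ∨ b < m) :
    ∃ x y z, x < m ∧ y < m ∧ z < m ∧ a ≤ x ∧ x < b ∧ a ≤ z ∧ z < b ∧ ¬ (a ≤ y ∧ y < b) ∧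
      simplePos m x < simplePos m y ∧ simplePos m y < simplePos m z := by
  unfold simplePos
  by_cases ha : 0 < a
  · by_cases hodd : a % 2 = 1
    · exact ⟨a, 0, a + 1, by grind⟩
    · exact ⟨a + 1, 0, a, by grind⟩
  · by_cases hodd : b % 2 = 1
    · exact ⟨1, b, 0, by grind⟩
    · by_cases hb2 : b = 2
      · exact ⟨1, 3, 0, by grind⟩
      · exact ⟨0, b, 2, by grind⟩

/-- The rank of a vertex in `V`, counted from `0`. -/
theorem exists_rank (V : Finset (Fin k)) :
    ∃ rank : Fin k → ℕ, (∀ x ∈ V, rank x < V.card) ∧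
      (∀ x ∈ V, ∀ y ∈ V, rank x < rank y ↔ x < y) ∧ ∀ n < V.card, ∃ x ∈ V, rank x = n := by
  classical
  let e := V.orderIsoOfFin rfl
  refine ⟨fun x => if h : x ∈ V then (e.symm ⟨x, h⟩).val else 0, fun x hx => ?_,
    fun x hx y hy => ?_, fun n hn => ?_⟩
  · simp only [hx, dif_pos]; exact (e.symm ⟨x, hx⟩).isLt
  · simp only [hx, hy, dif_pos, Fin.val_fin_lt, OrderIso.lt_iff_lt, Subtype.mk_lt_mk]
  · refine ⟨e ⟨n, hn⟩, (e ⟨n, hn⟩).2, ?_⟩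
    simp

/-- For `V.card ≥ 5` some arrangement of the letters of `V` has no blocks other than the unavoidable
ones. -/
theorem exists_simple {V : Finset (Fin k)} {M : Fin k} (hM : M ∈ V) (hVM : ∀ x ∈ V, x ≤ M)
    (hV : 5 ≤ V.card) :
    ∃ pos : Fin k → ℤ, (∀ x ∈ V, ∀ y ∈ V, x < M → y < M → pos x = pos y → x = y) ∧
      ∀ a ∈ V, ∀ b ∈ V, a < b → (IsBlock V M pos a b ↔ (boundary V).Adj a b) := by
  obtain ⟨rank, hlt, hmono, hsurj⟩ := exists_rank V
  have hinj : ∀ x ∈ V, ∀ y ∈ V, rank x = rank y → x = y := by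
    intro x hx y hy h
    have h1 := hmono x hx y hy
    have h2 := hmono y hy x hx
    rw [h] at h1 h2
    simp only [lt_irrefl, false_iff] at h1 h2
    order
  have hle : ∀ x ∈ V, ∀ y ∈ V, rank x ≤ rank y ↔ x ≤ y := fun x hx y hy => by
    rw [← not_lt, ← not_lt, hmono y hy x hx]
  have hMrank : rank M = V.card - 1 := by
    obtain ⟨x, hx, hxr⟩ := hsurj (V.card - 1) (by omega)
    have := (hle x hx M hM).2 (hVM x hx)
    have := hlt M hM
    omega
  have hletter : ∀ x ∈ V, rank x < V.card - 1 ↔ x < M := fun x hx => by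
    rw [← hMrank, hmono x hx M hM]
  refine ⟨fun x => simplePos (V.card - 1) (rank x), fun x hx y hy hxM hyM h => hinj x hx y hy
    (simplePos_injOn ((hletter x hx).2 hxM) ((hletter y hy).2 hyM) h), fun a ha b hb hab =>
    ⟨fun h => ?_, isBlock_of_boundary hM hVM _ hab⟩⟩
  by_contra hbd
  rw [boundary_adj_iff] at hbd
  have : ∃ w ∈ V, ∃ x ∈ V, Between a b w ∧ Outside a b x := by grind
  obtain ⟨w, hw, t, ht, h1, h2⟩ := this
  have hw1 : a < w := by unfold Between at h1; grind
  have hw2 : w < b := by unfold Between at h1; grind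
  have ht' : t < a ∨ b < t := by unfold Outside at h2; grind
  rw [← hmono _ ha _ hw] at hw1
  rw [← hmono _ hw _ hb] at hw2
  rw [← hmono _ ht _ ha, ← hmono _ hb _ ht] at ht'
  have := hlt t ht
  have := hlt b hb
  obtain ⟨x, y, z, hx, hy, hz, hax, hxb, haz, hzb, hy', hxy, hyz⟩ :=
    simplePos_not_block (m := V.card - 1) (a := rank a) (b := rank b) (by omega) (by omega)
      (by omega) (by omega)
  obtain ⟨x, hxV, rfl⟩ := hsurj x (by omega)
  obtain ⟨y, hyV, rfl⟩ := hsurj y (by omega)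
  obtain ⟨z, hzV, rfl⟩ := hsurj z (by omega)
  rw [hle _ ha _ hxV] at hax
  rw [hle _ ha _ hzV] at haz
  rw [hmono _ hxV _ hb] at hxb
  rw [hmono _ hzV _ hb] at hzb
  rw [hle _ ha _ hyV, hmono _ hyV _ hb] at hy'
  exact hy' (h x hxV y hyV z hzV ((hletter y hyV).1 hy) hax hxb haz hzb hxy hyz)

/-! ### The permutation of a dissection -/

/-- By induction on `V.card`: a cut-out polygon that is not a region is split along a member of `D`,
and the arrangements of the two parts are glued. A complete region gets the increasing arrangement,
any other region a simple one. -/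
theorem exists_arrangement {D E : SimpleGraph (Fin k)}
    (hsides : ∀ u v, (boundary Finset.univ).Adj u v ∨ D.Adj u v → E.Adj u v)
    (hcross : ∀ u v p q, E.Adj u v → D.Adj p q → ¬ Interleaves u v p q)
    (hregion : ∀ R, IsRegion D R → (∀ a ∈ R, ∀ b ∈ R, a ≠ b → E.Adj a b) ∨
      (5 ≤ R.card ∧ ∀ a ∈ R, ∀ b ∈ R, E.Adj a b ↔ (boundary R).Adj a b))
    {V : Finset (Fin k)} {M : Fin k} (hM : M ∈ V) (hVM : ∀ x ∈ V, x ≤ M) (hc : 2 ≤ V.card)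
    (hV : IsCutOut D V) :
    ∃ pos : Fin k → ℤ, (∀ x ∈ V, ∀ y ∈ V, x < M → y < M → pos x = pos y → x = y) ∧
      ∀ a ∈ V, ∀ b ∈ V, a < b → (IsBlock V M pos a b ↔ E.Adj a b) := by
  obtain ⟨n, hn⟩ : ∃ n, V.card = n := ⟨_, rfl⟩
  induction n using Nat.strong_induction_on generalizing V M with
  | _ n ih =>
    subst hn
    have complete : (∀ a ∈ V, ∀ b ∈ V, a ≠ b → E.Adj a b) →
        ∃ pos : Fin k → ℤ, (∀ x ∈ V, ∀ y ∈ V, x < M → y < M → pos x = pos y → x = y) ∧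
          ∀ a ∈ V, ∀ b ∈ V, a < b → (IsBlock V M pos a b ↔ E.Adj a b) := by
      intro h
      refine ⟨fun x => (x.val : ℤ), fun x _ y _ _ _ e => Fin.ext (Nat.cast_injective (R := ℤ) e),
        fun a ha b hb hab => iff_of_true ?_ (h a ha b hb hab.ne)⟩
      intro x _ y _ z _ _ h1 h2 h3 h4 h5 h6
      have h5 : x < y := Fin.lt_def.2 (Nat.cast_lt (α := ℤ).1 h5)
      have h6 : y < z := Fin.lt_def.2 (Nat.cast_lt (α := ℤ).1 h6)
      constructor <;> order
    rcases hc.eq_or_lt with hc2 | hc3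
    · exact complete fun a ha b hb hab =>
        hsides a b (hV a b (boundary_adj_of_card_le (by omega) hab ha hb))
    by_cases hR : IsRegion D V
    · rcases hregion V hR with h | ⟨h5, h⟩
      · exact complete h
      · obtain ⟨pos, hinj, hpos⟩ := exists_simple hM hVM h5
        exact ⟨pos, hinj, fun a ha b hb hab => (hpos a ha b hb hab).trans (h a ha b hb).symm⟩
    obtain ⟨i, hi, j, hj, hij, hD, ⟨w, hw, hw'⟩, ⟨x, hx, hx'⟩⟩ := exists_cut hV hc3 hR
    have hjM := hVM j hj
    obtain ⟨f, hf, hfE⟩ := ih (V.filter fun x => ¬ (i < x ∧ x < j)).card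
      (Finset.card_lt_card (Finset.filter_ssubset.2 ⟨w, hw, by grind⟩))
      (V := V.filter fun x => ¬ (i < x ∧ x < j)) (M := M) (by simp [hM]; grind)
      (fun x hx => hVM x (Finset.mem_filter.1 hx).1)
      (Finset.one_lt_card.2 ⟨i, by simp [hi], j, by simp [hj], hij.ne⟩)
      (hV.outer hi hj hij hD) rfl
    obtain ⟨g, hg, hgE⟩ := ih (V.filter fun x => i ≤ x ∧ x ≤ j).card
      (Finset.card_lt_card (Finset.filter_ssubset.2 ⟨x, hx, by grind⟩))
      (V := V.filter fun x => i ≤ x ∧ x ≤ j) (M := j) (by simp [hj, hij.le])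
      (fun x hx => (Finset.mem_filter.1 hx).2.2)
      (Finset.one_lt_card.2 ⟨i, by simp [hi, hij.le], j, by simp [hj, hij.le], hij.ne⟩)
      (hV.inner hi hj hij hD) rfl
    obtain ⟨pos, hinj, hin, hout, hno⟩ :=
      exists_block_inflation hVM hi hj hij ⟨w, hw, hw'⟩ hf hg
    refine ⟨pos, hinj, fun a ha b hb hab => ?_⟩
    by_cases h1 : i ≤ a ∧ b ≤ j
    · rw [hin a ha b hb h1.1 hab h1.2]
      exact hgE a (by simp [ha, h1.1]; order) b (by simp [hb, h1.2]; order) hab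
    by_cases h2 : ¬ (i < a ∧ a < j) ∧ ¬ (i < b ∧ b < j)
    · rw [hout a ha b hb h2.1 h2.2 hab]
      exact hfE a (Finset.mem_filter.2 ⟨ha, h2.1⟩) b (Finset.mem_filter.2 ⟨hb, h2.2⟩) hab
    · refine iff_of_false (hno a ha b hb (by grind)) fun h => hcross a b i j h hD ?_
      unfold Interleaves Between Outside
      grind

/-- Sorting the letters by their positions turns an arrangement of all the letters into a
permutation. -/
theorem exists_perm (M : Fin k) (hM : M.val = k - 1) {pos : Fin k → ℤ}
    (hpos : ∀ x y, x < M → y < M → pos x = pos y → x = y) :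
    ∃ π : Equiv.Perm (Fin (k - 1)), ∀ u v, u < v →
      ((permGraph π).Adj u v ↔ IsBlock Finset.univ M pos u v) := by
  set f : Fin (k - 1) → ℤ := fun x => pos (x.castLE (Nat.sub_le k 1)) with hf
  have hinj : Function.Injective f := fun x y h => by
    have := hpos _ _ (by rw [Fin.lt_def, hM]; exact x.isLt) (by rw [Fin.lt_def, hM]; exact y.isLt) h
    exact Fin.castLE_injective _ this
  have hmono : StrictMono (f ∘ Tuple.sort f) :=
    (Tuple.monotone_sort f).strictMono_of_injective (hinj.comp (Tuple.sort f).injective)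
  refine ⟨Tuple.sort f, fun u v huv => ?_⟩
  rw [permGraph_adj_iff _ huv, isContiguous_iff_isBlock _ hM (fun x y => ?_) huv]
  rw [← hmono.lt_iff_lt]
  simp [hf]

theorem exists_permGraph_eq (hk : 3 ≤ k) {D : SimpleGraph (Fin k)} {K : Set (Finset (Fin k))}
    (hD : IsNoncrossing D) (hK : ∀ R, IsRegion D R → R.card = 4 → R ∈ K) :
    ∃ π : Equiv.Perm (Fin (k - 1)), permGraph π = dissectionGraph D K := by
  have hsides : ∀ u v, (boundary Finset.univ).Adj u v ∨ D.Adj u v →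
      (dissectionGraph D K).Adj u v := by
    intro u v huv
    have hne : u ≠ v := by rcases huv with h | h <;> exact h.ne
    obtain ⟨R, hR, hu, hv⟩ := exists_region (D := D) (u := u) (v := v) hk fun p q hpq hi => by
      rcases huv with h | h
      · obtain ⟨-, -, -, hb⟩ := boundary_adj_iff.1 h
        unfold Interleaves at hi
        have := hb.imp (fun h => And.intro (h p (Finset.mem_univ _)) (h q (Finset.mem_univ _)))
          (fun h => And.intro (h p (Finset.mem_univ _)) (h q (Finset.mem_univ _)))
        tauto
      · exact hD u v p q h hpq hi
    refine ⟨R, hR, ?_⟩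
    by_cases hRK : R ∈ K
    · exact Or.inl ⟨hRK, hne, hu, hv⟩
    · refine Or.inr ⟨hRK, ?_⟩
      rcases huv with h | h
      · exact boundary_of_subset (Finset.subset_univ _) hu hv h
      · exact hR.undivided u hu v hv h
  have hcross : ∀ u v p q, (dissectionGraph D K).Adj u v → D.Adj p q → ¬ Interleaves u v p q := by
    rintro u v p q ⟨R, hR, ⟨-, h⟩ | ⟨-, h⟩⟩ hpq
    · exact hR.not_interleaves hD h.2.1 h.2.2 hpq
    · exact hR.not_interleaves hD h.2.1 h.2.2.1 hpq
  have hregion : ∀ R, IsRegion D R → (∀ a ∈ R, ∀ b ∈ R, a ≠ b → (dissectionGraph D K).Adj a b) ∨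
      (5 ≤ R.card ∧ ∀ a ∈ R, ∀ b ∈ R, (dissectionGraph D K).Adj a b ↔ (boundary R).Adj a b) := by
    intro R hR
    by_cases hRK : R ∈ K
    · exact Or.inl fun a ha b hb hab => ⟨R, hR, Or.inl ⟨hRK, hab, ha, hb⟩⟩
    by_cases h3 : R.card ≤ 3
    · exact Or.inl fun a ha b hb hab =>
        ⟨R, hR, Or.inr ⟨hRK, boundary_adj_of_card_le h3 hab ha hb⟩⟩
    have h4 : R.card ≠ 4 := fun h => hRK (hK R hR h)
    refine Or.inr ⟨by omega, fun a ha b hb => ⟨?_, fun h => ⟨R, hR, Or.inr ⟨hRK, h⟩⟩⟩⟩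
    intro h
    have hab := h.ne
    obtain ⟨S, hS, h⟩ := h
    by_contra hbd
    have haS : a ∈ S := by rcases h with h | h; exacts [h.2.2.1, h.2.2.1]
    have hbS : b ∈ S := by rcases h with h | h; exacts [h.2.2.2, h.2.2.2.1]
    have := hR.eq_of_not_boundary hD hS hab ha hb haS hbS hbd
    subst this
    rcases h with h | h
    · exact hRK h.1
    · exact hbd h.2
  obtain ⟨pos, hinj, hpos⟩ := exists_arrangement hsides hcross hregion
    (V := Finset.univ) (M := ⟨k - 1, by omega⟩) (Finset.mem_univ _)
    (fun x _ => by rw [Fin.le_def]; simp only; omega) (by simp; omega) (fun _ _ h => Or.inl h)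
  obtain ⟨π, hπ⟩ := exists_perm ⟨k - 1, by omega⟩ rfl
    fun x y hx hy h => hinj x (Finset.mem_univ _) y (Finset.mem_univ _) hx hy h
  refine ⟨π, ?_⟩
  ext u v
  rcases lt_trichotomy u v with h | rfl | h
  · exact (hπ u v h).trans (hpos u (Finset.mem_univ _) v (Finset.mem_univ _) h)
  · simp
  · rw [SimpleGraph.adj_comm, SimpleGraph.adj_comm (dissectionGraph D K)]
    exact (hπ v u h).trans (hpos v (Finset.mem_univ _) u (Finset.mem_univ _) h)

theorem mainTheorem4 (k : ℕ) (A : Fin k → EuclideanSpace ℝ (Fin 2)) (hA : IsConvexPolygon A) :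
    (∀ π : Equiv.Perm (Fin (k - 1)),
      IsDissection A (noncrossingDiagonals A (permGraph π)) ∧
      (∀ R, IsRegion (noncrossingDiagonals A (permGraph π)) R →
        (R.card ≠ 4 ∧
          ∀ u ∈ R, ∀ v ∈ R, ((permGraph π).Adj u v ↔ (boundary R).Adj u v)) ∨
        (∀ u ∈ R, ∀ v ∈ R, ((permGraph π).Adj u v ↔ (completeOn R).Adj u v))) ∧
      (∀ u v, (permGraph π).Adj u v →
        ∃ R, IsRegion (noncrossingDiagonals A (permGraph π)) R ∧ u ∈ R ∧ v ∈ R)) ∧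
    (∀ (D : SimpleGraph (Fin k)) (K : Set (Finset (Fin k))), IsDissection A D →
      (∀ R, IsRegion D R → R.card = 4 → R ∈ K) →
      ∃ π : Equiv.Perm (Fin (k - 1)), permGraph π = dissectionGraph D K) :=
  ⟨permGraph_dissection hA, fun _ _ hD hK => exists_permGraph_eq hA.1
    (fun u v x y huv hxy h => hD.noncrossing u v x y huv hxy
      ((crosses_iff_interleaves hA huv.ne hxy.ne).2 h)) hK⟩
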